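/- \textbf{Setting.} WMSO+B is weak monadic second-order logic (set variables range over finite subsets) extended by the bounding quantifier $\mathsf{B}X\,\varphi$, which holds in $\mathcal A$ iff there is $b\in\mathbb N$ such that every finite set $X$ satisfying $\varphi$ has at most $b$ elements. The quantifier rank is the maximal number of nested quantifiers (of any kind). The \emph{$k$-round WMSO+B-EF-game} on two structures $\mathcal A,\mathcal B$ over the same finite relational signature is played by spoiler and duplicator. In each round spoiler plays one of the following moves. \emph{Element move}: spoiler chooses an element of one structure and duplicator answers with an element of the other. \emph{Set move}: spoiler chooses a finite subset of one structure and duplicator answers with a finite subset of the other. \emph{Bound move}: spoiler chooses one of the two structures and $l\in\mathbb N$, duplicator chooses $m\in\mathbb N$, then spoiler chooses a finite subset of his structure with at least $m$ elements and duplicator answers with a finite subset of the other structure with at least $l$ elements. If after $k$ rounds the chosen elements are $a_1,\dots,a_s$ in $\mathcal A$ and $b_1,\dots,b_s$ in $\mathcal B$ and the chosen sets are $A_1,\dots,A_t$ and $B_1,\dots,B_t$ (listed in the order of the rounds), duplicator wins iff $a_i\in A_j\Leftrightarrow b_i\in B_j$ and $a_i=a_j\Leftrightarrow b_i=b_j$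 for all $i,j$, and $(a_{i_1},\dots,a_{i_r})\in R^{\mathcal A}\Leftrightarrow(b_{i_1},\dots,b_{i_r})\in R^{\mathcal B}$ for every relation symbol $R$ and all indices. For $n,m\in\mathbb N$ the \emph{$(n,m)$-triple-u} is the $\{<,\bot\}$-structure with the $7+n+m$ elements $l,r,a_1,a_2,b_1,b_2,b_3,x_1,\dots,x_n,y_1,\dots,y_m$, where $<$ is the least strict partial order with $l<b_1$, $a_1<b_1$, $a_1<b_2$, $a_2<b_2$, $a_2<b_3$, $r<b_3$, $x_1<\dots<x_n<a_1$ and $y_1<\dots<y_m<a_2$, and $\bot=\{(l,r),(r,l)\}$. Let $k\in\mathbb N$ and let $n_1<n_2<n_3<\cdots$ be natural numbers such that for all $i,j\ge 1$ the finite linear orders (with signature $\{<\}$) of length $n_i$ and of length $n_j$ satisfy the same WMSO+B-sentences of quantifier rank at most $k$. Let $\mathcal E_k$ be the disjoint union of countably infinitely many $(n_1,n_j)$-triple-u's and countably infinitely many $(n_j,n_1)$-triple-u's for every $j\ge 2$, together with one additional node $d$ and an additional pair $W.l<d$ for each of these triple-u's $W$, where $W.l$ denotes the node $l$ of $W$.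 Let $\mathcal U_k$ be the disjoint union of countably infinitely many $(n_j,n_j)$-triple-u's for every $j\ge 2$, together with one additional node $d$ and an additional pair $W.l<d$ for each of these triple-u's $W$. \textbf{Proposition.} Duplicator has a winning strategy in the $k$-round WMSO+B-EF-game on $(\mathcal E_k,\mathcal U_k)$. -/

import Mathlib

namespace WMSOB

/-- Formulas of weak monadic second-order logic with the bounding quantifier over a (relational)
signature `L`, with `p` free element variables and `q` free set variables (de Bruijn levels:
a quantifier binds the variable with the largest index). -/
inductive Formula (L : FirstOrder.Language.{0, 0}) : ℕ → ℕ → Type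
  /-- `R(x_{t 1}, …, x_{t r})` -/
  | rel {p q r : ℕ} (R : L.Relations r) (t : Fin r → Fin p) : Formula L p q
  /-- `x_i = x_j` -/
  | eq {p q : ℕ} (i j : Fin p) : Formula L p q
  /-- `x_i ∈ X_j` -/
  | mem {p q : ℕ} (i : Fin p) (j : Fin q) : Formula L p q
  | not {p q : ℕ} (φ : Formula L p q) : Formula L p q
  | and {p q : ℕ} (φ ψ : Formula L p q) : Formula L p q
  /-- `∃ x, φ` -/
  | exElem {p q : ℕ} (φ : Formula L (p + 1) q) : Formula L p q
  /-- `∃ X, φ`, with `X` ranging over finite sets -/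
  | exSet {p q : ℕ} (φ : Formula L p (q + 1)) : Formula L p q
  /-- the bounding quantifier `B X, φ` -/
  | bound {p q : ℕ} (φ : Formula L p (q + 1)) : Formula L p q

/-- The quantifier rank: the maximal number of nested quantifiers. -/
def Formula.rank {L : FirstOrder.Language.{0, 0}} : {p q : ℕ} → Formula L p q → ℕ
  | _, _, .rel _ _ => 0
  | _, _, .eq _ _ => 0
  | _, _, .mem _ _ => 0
  | _, _, .not φ => φ.rank
  | _, _, .and φ ψ => max φ.rank ψ.rank
  | _, _, .exElem φ => φ.rank + 1
  | _, _, .exSet φ => φ.rank + 1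
  | _, _, .bound φ => φ.rank + 1

/-- `φ.Holds a X`: the structure `A` satisfies `φ` when the `i`-th element variable is `a i` and
the `j`-th set variable is the finite set `X j`. -/
def Formula.Holds {L : FirstOrder.Language.{0, 0}} {A : Type} [L.Structure A] :
    {p q : ℕ} → Formula L p q → (Fin p → A) → (Fin q → Finset A) → Prop
  | _, _, .rel R t, a, _ => FirstOrder.Language.Structure.RelMap R (fun s => a (t s))
  | _, _, .eq i j, a, _ => a i = a j
  | _, _, .mem i j, a, X => a i ∈ X j
  | _, _, .not φ, a, X => ¬ φ.Holds a X
  | _, _, .and φ ψ, a, X => φ.Holds a X ∧ ψ.Holds a X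
  | _, _, .exElem φ, a, X => ∃ x : A, φ.Holds (Fin.snoc (α := fun _ => A) a x) X
  | _, _, .exSet φ, a, X => ∃ S : Finset A, φ.Holds a (Fin.snoc (α := fun _ => Finset A) X S)
  | _, _, .bound φ, a, X =>
      ∃ b : ℕ, ∀ S : Finset A, φ.Holds a (Fin.snoc (α := fun _ => Finset A) X S) → S.card ≤ b

/-- `A` and `B` satisfy the same WMSO+B sentences of quantifier rank at most `k`. -/
def Equivalent (L : FirstOrder.Language.{0, 0}) (k : ℕ) (A B : Type) [L.Structure A] [L.Structure B] :
    Prop :=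
  ∀ φ : Formula L 0 0, φ.rank ≤ k →
    (φ.Holds (A := A) Fin.elim0 Fin.elim0 ↔ φ.Holds (A := B) Fin.elim0 Fin.elim0)

/-- The winning condition for duplicator in a final position `(A, a, X, B, b, Y)` of the game. -/
def FinalWin (L : FirstOrder.Language.{0, 0}) {A B : Type} [L.Structure A] [L.Structure B] {p q : ℕ}
    (a : Fin p → A) (X : Fin q → Finset A) (b : Fin p → B) (Y : Fin q → Finset B) : Prop :=
  (∀ (i : Fin p) (j : Fin q), a i ∈ X j ↔ b i ∈ Y j) ∧
  (∀ i j : Fin p, a i = a j ↔ b i = b j) ∧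
  (∀ (r : ℕ) (R : L.Relations r) (t : Fin r → Fin p),
    FirstOrder.Language.Structure.RelMap R (fun s => a (t s)) ↔
      FirstOrder.Language.Structure.RelMap R (fun s => b (t s)))

/-- Duplicator has a winning strategy in the WMSO+B Ehrenfeucht–Fraïssé game with the given number
of remaining rounds, started in the position `(A, a, X, B, b, Y)`. In each round spoiler plays an
element move, a set move or a bound move, in one of the two structures. -/
def DuplicatorWins (L : FirstOrder.Language.{0, 0}) {A B : Type} [L.Structure A] [L.Structure B] :
    (rounds : ℕ) → {p q : ℕ} → (Fin p → A) → (Fin q → Finset A) →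
      (Fin p → B) → (Fin q → Finset B) → Prop
  | 0, _, _, a, X, b, Y => FinalWin L a X b Y
  | k + 1, _, _, a, X, b, Y =>
    -- element moves
    (∀ x : A, ∃ y : B, DuplicatorWins L k
      (Fin.snoc (α := fun _ => A) a x) X (Fin.snoc (α := fun _ => B) b y) Y) ∧
    (∀ y : B, ∃ x : A, DuplicatorWins L k
      (Fin.snoc (α := fun _ => A) a x) X (Fin.snoc (α := fun _ => B) b y) Y) ∧
    -- set moves
    (∀ S : Finset A, ∃ T : Finset B, DuplicatorWins L k
      a (Fin.snoc (α := fun _ => Finset A) X S) b (Fin.snoc (α := fun _ => Finset B) Y T)) ∧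
    (∀ T : Finset B, ∃ S : Finset A, DuplicatorWins L k
      a (Fin.snoc (α := fun _ => Finset A) X S) b (Fin.snoc (α := fun _ => Finset B) Y T)) ∧
    -- bound moves: spoiler picks a structure and `l`, duplicator replies `m`, spoiler picks a set
    -- of size at least `m` in his structure, duplicator a set of size at least `l` in the other
    (∀ l : ℕ, ∃ m : ℕ, ∀ S : Finset A, m ≤ S.card → ∃ T : Finset B, l ≤ T.card ∧
      DuplicatorWins L k
        a (Fin.snoc (α := fun _ => Finset A) X S) b (Fin.snoc (α := fun _ => Finset B) Y T)) ∧
    (∀ l : ℕ, ∃ m : ℕ, ∀ T : Finset B, m ≤ T.card → ∃ S : Finset A, l ≤ S.card ∧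
      DuplicatorWins L k
        a (Fin.snoc (α := fun _ => Finset A) X S) b (Fin.snoc (α := fun _ => Finset B) Y T))

/-- Duplicator has a winning strategy in the `k`-round WMSO+B game on `(A, B)`. -/
def DuplicatorHasWinningStrategy (L : FirstOrder.Language.{0, 0}) (k : ℕ) (A B : Type)
    [L.Structure A] [L.Structure B] : Prop :=
  DuplicatorWins L k (A := A) (B := B) Fin.elim0 Fin.elim0 Fin.elim0 Fin.elim0

/-- The only symbol of the signature `{<}`. -/
inductive LtRel : ℕ → Type
  | lt : LtRel 2

/-- The signature `{<}`. -/
def ltLang : FirstOrder.Language.{0, 0} := ⟨fun _ => Empty, LtRel⟩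

/-- The linear order of length `n`, as a structure over `{<}`. -/
instance finLtStructure (n : ℕ) : ltLang.Structure (Fin n) where
  funMap := fun f _ => Empty.elim f
  RelMap := fun R =>
    match R with
    | LtRel.lt => fun v => v 0 < v 1

/-- The symbols of the signature `{<, ⊥}`. -/
inductive LtPerpRel : ℕ → Type
  | lt : LtPerpRel 2
  | perp : LtPerpRel 2

/-- The signature `{<, ⊥}`. -/
def ltPerpLang : FirstOrder.Language.{0, 0} := ⟨fun _ => Empty, LtPerpRel⟩

/-- The domain of the standard `(n, m)`-triple-u. -/
inductive TripleU (n m : ℕ) : Type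
  | l | r | a₁ | a₂ | b₁ | b₂ | b₃
  /-- the left order, attached below `a₁` -/
  | left (i : Fin n)
  /-- the right order, attached below `a₂` -/
  | right (i : Fin m)

/-- The strict partial order of the standard `(n, m)`-triple-u: the least transitive relation that
contains the order `l, a₁ < b₁`; `a₁, a₂ < b₂`; `a₂, r < b₃` of the plain triple-u, the
chain `left 0 < ⋯ < left (n - 1) < a₁` and the chain `right 0 < ⋯ < right (m - 1) < a₂`. -/
inductive TripleU.Lt {n m : ℕ} : TripleU n m → TripleU n m → Prop
  | l_b₁ : Lt .l .b₁
  | a₁_b₁ : Lt .a₁ .b₁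
  | a₁_b₂ : Lt .a₁ .b₂
  | a₂_b₂ : Lt .a₂ .b₂
  | a₂_b₃ : Lt .a₂ .b₃
  | r_b₃ : Lt .r .b₃
  | left_left {i j : Fin n} (h : i < j) : Lt (.left i) (.left j)
  | left_a₁ (i : Fin n) : Lt (.left i) .a₁
  | left_b₁ (i : Fin n) : Lt (.left i) .b₁
  | left_b₂ (i : Fin n) : Lt (.left i) .b₂
  | right_right {i j : Fin m} (h : i < j) : Lt (.right i) (.right j)
  | right_a₂ (i : Fin m) : Lt (.right i) .a₂
  | right_b₂ (i : Fin m) : Lt (.right i) .b₂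
  | right_b₃ (i : Fin m) : Lt (.right i) .b₃

/-- The relation `⊥` of the standard `(n, m)`-triple-u. -/
inductive TripleU.Perp {n m : ℕ} : TripleU n m → TripleU n m → Prop
  | l_r : Perp .l .r
  | r_l : Perp .r .l

/-- The domain of the disjoint union, over `i : ι`, of one `(p i, q i)`-triple-u for each `i`,
together with one additional final node. -/
inductive TripleUUnion (ι : Type) (p q : ι → ℕ) : Type
  | node (i : ι) (x : TripleU (p i) (q i))
  | final

/-- `<` on the disjoint union of triple-u's with final node `d`: the orders of the triple-u's, and
an edge from the node `l` of each triple-u to `d`. -/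
inductive TripleUUnion.Lt {ι : Type} {p q : ι → ℕ} :
    TripleUUnion ι p q → TripleUUnion ι p q → Prop
  | inner (i : ι) {x y : TripleU (p i) (q i)} (h : x.Lt y) : Lt (.node i x) (.node i y)
  | toFinal (i : ι) : Lt (.node i .l) .final

/-- `⊥` on the disjoint union of triple-u's with final node. -/
inductive TripleUUnion.Perp {ι : Type} {p q : ι → ℕ} :
    TripleUUnion ι p q → TripleUUnion ι p q → Prop
  | inner (i : ι) {x y : TripleU (p i) (q i)} (h : x.Perp y) : Perp (.node i x) (.node i y)

instance tripleUUnionStructure (ι : Type) (p q : ι → ℕ) :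
    ltPerpLang.Structure (TripleUUnion ι p q) where
  funMap := fun f _ => Empty.elim f
  RelMap := fun R =>
    match R with
    | LtPerpRel.lt => fun v => TripleUUnion.Lt (v 0) (v 1)
    | LtPerpRel.perp => fun v => TripleUUnion.Perp (v 0) (v 1)

/-- The embeddable structure for the sequence `n 1 < n 2 < ⋯`: for each `j ≥ 2`, countably
infinitely many `(n 1, n j)`-triple-u's (flag `true`) and countably infinitely many
`(n j, n 1)`-triple-u's (flag `false`), and the final node. -/
abbrev Embeddable (n : ℕ → ℕ) : Type :=
  TripleUUnion ({j : ℕ // 2 ≤ j} × Bool × ℕ)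
    (fun c => if c.2.1 = true then n 1 else n c.1)
    (fun c => if c.2.1 = true then n c.1 else n 1)

/-- The unembeddable structure for the sequence `n 1 < n 2 < ⋯`: for each `j ≥ 2`, countably
infinitely many `(n j, n j)`-triple-u's, and the final node. -/
abbrev Unembeddable (n : ℕ → ℕ) : Type :=
  TripleUUnion ({j : ℕ // 2 ≤ j} × ℕ) (fun c => n c.1) (fun c => n c.1)

end WMSOB

/-! Both structures are disjoint unions of triple-u's plus `final`. The nodes of a triple-u split
into seven base nodes and two linear orders, and whether an order node lies below a base node
depends only on which order it is in. So a play on two triple-u's splits into copying on the base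
nodes and independent games on the two pairs of orders. The orders are finite, so equivalence up to
rank `k` gives answers to element and set moves there (`EquivalentAt.chainWins`), and
`ComponentWins` combines them.

On the unions, duplicator keeps a finite matching of triple-u's, winning on each matched pair, with
the position empty elsewhere (`ExistsMatching`). A newly touched triple-u is matched with a fresh
one: every kind occurs infinitely often, and an `(n 1, n j)`- or `(n j, n 1)`-triple-u has the `(n
j, n j)`-triple-u as a partner, since all the orders involved are equivalent.

The bound moves require size control. The triple-u's already matched hold at most a constant number
`N` of nodes, which is fixed before spoiler picks his set. In a new triple-u the partner shares one
order with it, on which duplicator copies. From `Embeddable`, the shared order is the long one and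
the other has at most `n 1` nodes. From `Unembeddable`, duplicator picks the partner that shares the
order holding the larger part of the set. Either way the nonempty answer is smaller by at most a
factor `c = 9 + n 1` (`FreshAnswers`). Fresh partners being distinct, summation gives `S.card ≤ N +
c * T.card` (`ExistsMatching.exists_set`), so large sets have large answers. Hence the games on
orders and on single triple-u's need no bound moves. -/

namespace WMSOB

/-! ### Answering moves in a finite structure from equality of bounded-rank theories -/

section Logic

variable {L : FirstOrder.Language.{0, 0}} {A B : Type} [L.Structure A] [L.Structure B]

/-- The two positions satisfy the same formulas of quantifier rank at most `k`. -/
def EquivalentAt (L : FirstOrder.Language.{0, 0}) {A B : Type} [L.Structure A] [L.Structure B]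
    (k : ℕ) {p q : ℕ} (a : Fin p → A) (X : Fin q → Finset A) (b : Fin p → B)
    (Y : Fin q → Finset B) : Prop :=
  ∀ φ : Formula L p q, φ.rank ≤ k → (φ.Holds a X ↔ φ.Holds b Y)

theorem EquivalentAt.mono {k k' p q : ℕ} {a : Fin p → A} {X : Fin q → Finset A} {b : Fin p → B}
    {Y : Fin q → Finset B} (h : EquivalentAt L k' a X b Y) (hk : k ≤ k') :
    EquivalentAt L k a X b Y :=
  fun φ hφ => h φ (hφ.trans hk)

theorem EquivalentAt.symm {k p q : ℕ} {a : Fin p → A} {X : Fin q → Finset A} {b : Fin p → B}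
    {Y : Fin q → Finset B} (h : EquivalentAt L k a X b Y) : EquivalentAt L k b Y a X :=
  fun φ hφ => (h φ hφ).symm

theorem exists_formula_of_not_equivalentAt {k p q : ℕ} {a : Fin p → A} {X : Fin q → Finset A}
    {b : Fin p → B} {Y : Fin q → Finset B} (h : ¬ EquivalentAt L k a X b Y) :
    ∃ φ : Formula L p q, φ.rank ≤ k ∧ φ.Holds a X ∧ ¬ φ.Holds b Y := by
  simp only [EquivalentAt, not_forall] at h
  obtain ⟨φ, hφ, h⟩ := h
  by_cases ha : φ.Holds a X
  · exact ⟨φ, hφ, ha, fun hb => h ⟨fun _ => hb, fun _ => ha⟩⟩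
  · refine ⟨.not φ, hφ, ha, fun hb => h ⟨fun h' => absurd h' ha, fun h' => absurd h' hb⟩⟩

/-- Nonemptiness of `ι` matters: without free variables there need be no formula of rank 0 to serve
as the empty conjunction. -/
theorem exists_conj {ι : Type} [Finite ι] [Nonempty ι] {k p q : ℕ} (φ : ι → Formula L p q)
    (hφ : ∀ i, (φ i).rank ≤ k) :
    ∃ ψ : Formula L p q, ψ.rank ≤ k ∧ ∀ (C : Type) [L.Structure C] (a : Fin p → C)
      (X : Fin q → Finset C), ψ.Holds a X ↔ ∀ i, (φ i).Holds a X := by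
  classical
  have := Fintype.ofFinite ι
  suffices H : ∀ s : Finset ι, s.Nonempty → ∃ ψ : Formula L p q, ψ.rank ≤ k ∧
      ∀ (C : Type) [L.Structure C] (a : Fin p → C)
        (X : Fin q → Finset C), ψ.Holds a X ↔ ∀ i ∈ s, (φ i).Holds a X by
    simpa using H Finset.univ Finset.univ_nonempty
  intro s hs
  induction hs using Finset.Nonempty.cons_induction with
  | singleton i => exact ⟨φ i, hφ i, by simp⟩
  | cons i s hi hs ih =>
    obtain ⟨ψ, hψ, h⟩ := ih
    refine ⟨.and (φ i) ψ, max_le (hφ i) hψ, fun C _ a X => ?_⟩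
    simp [Formula.Holds, h]

/-- If each answer `y` failed, it would be refuted by a formula of rank at most `k` true of `x`. As
`B` is finite, the conjunction of these formulas exists, and quantifying it existentially gives a
formula of rank at most `k + 1` that separates the positions. -/
theorem EquivalentAt.exists_elem [Finite B] {k p q : ℕ} {a : Fin p → A} {X : Fin q → Finset A}
    {b : Fin p → B} {Y : Fin q → Finset B} (h : EquivalentAt L (k + 1) a X b Y) (x : A) :
    ∃ y : B, EquivalentAt L k (Fin.snoc (α := fun _ => A) a x) X
      (Fin.snoc (α := fun _ => B) b y) Y := by
  by_contra! H
  -- The sentence `∃ x, x = x` transfers nonemptiness, which the conjunction requires.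
  have hB : Nonempty B := by
    obtain ⟨y, -⟩ := (h (.exElem (.eq (Fin.last p) (Fin.last p)))
      (by simp [Formula.rank])).1 ⟨x, rfl⟩
    exact ⟨y⟩
  choose φ hφ hx hy using fun y => exists_formula_of_not_equivalentAt (H y)
  obtain ⟨ψ, hψ, hψ'⟩ := exists_conj φ hφ
  obtain ⟨y, hy'⟩ := (h (.exElem ψ) (Nat.succ_le_succ hψ)).1 ⟨x, (hψ' _ _ _).2 hx⟩
  exact hy y ((hψ' _ _ _).1 hy' y)

theorem EquivalentAt.exists_set [Finite B] {k p q : ℕ} {a : Fin p → A} {X : Fin q → Finset A}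
    {b : Fin p → B} {Y : Fin q → Finset B} (h : EquivalentAt L (k + 1) a X b Y) (S : Finset A) :
    ∃ T : Finset B, EquivalentAt L k a (Fin.snoc (α := fun _ => Finset A) X S)
      b (Fin.snoc (α := fun _ => Finset B) Y T) := by
  by_contra! H
  choose φ hφ hx hy using fun y => exists_formula_of_not_equivalentAt (H y)
  obtain ⟨ψ, hψ, hψ'⟩ := exists_conj φ hφ
  obtain ⟨y, hy'⟩ := (h (.exSet ψ) (Nat.succ_le_succ hψ)).1 ⟨S, (hψ' _ _ _).2 hx⟩
  exact hy y ((hψ' _ _ _).1 hy' y)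

end Logic

/-! ### The set game on two linear orders -/

section Chain

/-- Duplicator wins the set game (without bound moves) on two linear orders from a position in
which an element variable is a set with at most one element: the empty set stands for an element
outside of the order. -/
def ChainWins {n m : ℕ} : ℕ → {p q : ℕ} → (Fin p → Finset (Fin n)) → (Fin q → Finset (Fin n)) →
    (Fin p → Finset (Fin m)) → (Fin q → Finset (Fin m)) → Prop
  | 0, _, _, E, X, F, Y =>
    (∀ i j, (∃ x ∈ E i, x ∈ X j) ↔ ∃ y ∈ F i, y ∈ Y j) ∧
    (∀ i j, (∃ x ∈ E i, x ∈ E j) ↔ ∃ y ∈ F i, y ∈ F j) ∧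
    (∀ i j, (∃ x ∈ E i, ∃ x' ∈ E j, x < x') ↔ ∃ y ∈ F i, ∃ y' ∈ F j, y < y')
  | k + 1, _, _, E, X, F, Y =>
    (∀ x, ∃ y, ChainWins k (Fin.snoc (α := fun _ => Finset (Fin n)) E {x}) X
      (Fin.snoc (α := fun _ => Finset (Fin m)) F {y}) Y) ∧
    (∀ y, ∃ x, ChainWins k (Fin.snoc (α := fun _ => Finset (Fin n)) E {x}) X
      (Fin.snoc (α := fun _ => Finset (Fin m)) F {y}) Y) ∧
    ChainWins k (Fin.snoc (α := fun _ => Finset (Fin n)) E ∅) X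
      (Fin.snoc (α := fun _ => Finset (Fin m)) F ∅) Y ∧
    (∀ S, ∃ T, ChainWins k E (Fin.snoc (α := fun _ => Finset (Fin n)) X S)
      F (Fin.snoc (α := fun _ => Finset (Fin m)) Y T)) ∧
    (∀ T, ∃ S, ChainWins k E (Fin.snoc (α := fun _ => Finset (Fin n)) X S)
      F (Fin.snoc (α := fun _ => Finset (Fin m)) Y T))

theorem ChainWins.symm {n m k p q : ℕ} {E : Fin p → Finset (Fin n)} {X : Fin q → Finset (Fin n)}
    {F : Fin p → Finset (Fin m)} {Y : Fin q → Finset (Fin m)} (h : ChainWins k E X F Y) :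
    ChainWins k F Y E X := by
  induction k generalizing p q with
  | zero => exact ⟨fun i j => (h.1 i j).symm, fun i j => (h.2.1 i j).symm,
      fun i j => (h.2.2 i j).symm⟩
  | succ k ih =>
    obtain ⟨h1, h2, h3, h4, h5⟩ := h
    exact ⟨fun x => (h2 x).imp fun _ => ih, fun x => (h1 x).imp fun _ => ih, ih h3,
      fun x => (h5 x).imp fun _ => ih, fun x => (h4 x).imp fun _ => ih⟩

theorem ChainWins.refl {n : ℕ} (k : ℕ) {p q : ℕ} (E : Fin p → Finset (Fin n))
    (X : Fin q → Finset (Fin n)) : ChainWins k E X E X := by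
  induction k generalizing p q with
  | zero => exact ⟨fun _ _ => Iff.rfl, fun _ _ => Iff.rfl, fun _ _ => Iff.rfl⟩
  | succ k ih => exact ⟨fun x => ⟨x, ih _ _⟩, fun x => ⟨x, ih _ _⟩, ih _ _, fun x => ⟨x, ih _ _⟩,
      fun x => ⟨x, ih _ _⟩⟩

/-- Applied with `g` equal to `singleton` for element variables and to `id` for set variables; `d`
is the empty set. -/
theorem elim_snoc {A M : Type} {p p' : ℕ} (f : Fin p' → Option (Fin p)) (g : A → M) (d : M)
    (a : Fin p → A) (x : A) :
    (fun i => ((Fin.snoc (α := fun _ => Option (Fin (p + 1))) (fun i => (f i).map Fin.castSucc)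
      (some (Fin.last p)) : Fin (p' + 1) → Option (Fin (p + 1))) i).elim d
        (fun j => g ((Fin.snoc (α := fun _ => A) a x : Fin (p + 1) → A) j))) =
    Fin.snoc (α := fun _ => M) (fun i => (f i).elim d (fun j => g (a j))) (g x) := by
  funext i
  refine Fin.lastCases ?_ (fun i => ?_) i
  · simp
  · simp only [Fin.snoc_castSucc]
    cases f i <;> simp

theorem elim_snoc_none {A M : Type} {p p' : ℕ} (f : Fin p' → Option (Fin p)) (g : A → M) (d : M)
    (a : Fin p → A) :
    (fun i => ((Fin.snoc (α := fun _ => Option (Fin p)) f none :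
        Fin (p' + 1) → Option (Fin p)) i).elim d (fun j => g (a j))) =
    Fin.snoc (α := fun _ => M) (fun i => (f i).elim d (fun j => g (a j))) d := by
  funext i
  refine Fin.lastCases ?_ (fun i => ?_) i <;> simp

/-- A round played outside of the order adds an empty variable to the chain position but no variable
to the logical one. The maps `f` and `g` record which chain variables come from logical variables,
`none` marking an empty one; the induction needs them arbitrary, since they grow with the rounds. -/
theorem EquivalentAt.chainWins {n m k p q p' q' : ℕ} {a : Fin p → Fin n}
    {X : Fin q → Finset (Fin n)} {b : Fin p → Fin m} {Y : Fin q → Finset (Fin m)}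
    (h : EquivalentAt ltLang k a X b Y) (f : Fin p' → Option (Fin p))
    (g : Fin q' → Option (Fin q)) :
    ChainWins k (fun i => (f i).elim ∅ (fun j => {a j})) (fun i => (g i).elim ∅ (fun j => id (X j)))
      (fun i => (f i).elim ∅ (fun j => {b j})) (fun i => (g i).elim ∅ (fun j => id (Y j))) := by
  induction k generalizing p q p' q' with
  | zero =>
    refine ⟨fun i j => ?_, fun i j => ?_, fun i j => ?_⟩
    · rcases hi : f i with _ | i'
      · simp [*]
      rcases hj : g j with _ | j'
      · simp [*]
      simpa [Formula.Holds, hi, hj] using h (.mem i' j') (by simp [Formula.rank])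
    · rcases hi : f i with _ | i'
      · simp [*]
      rcases hj : f j with _ | j'
      · simp [*]
      simpa [Formula.Holds, hi, hj] using h (.eq i' j') (by simp [Formula.rank])
    · rcases hi : f i with _ | i'
      · simp [*]
      rcases hj : f j with _ | j'
      · simp [*]
      have := h (.rel (r := 2) LtRel.lt ![i', j']) (by simp [Formula.rank])
      simpa [Formula.Holds, FirstOrder.Language.Structure.RelMap, hi, hj] using this
  | succ k ih =>
    refine ⟨fun x => ?_, fun y => ?_, ?_, fun S => ?_, fun T => ?_⟩
    · obtain ⟨y, hy⟩ := h.exists_elem x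
      refine ⟨y, ?_⟩
      have := ih hy (Fin.snoc (α := fun _ => Option (Fin (p + 1)))
        (fun i => (f i).map Fin.castSucc) (some (Fin.last p))) g
      rwa [elim_snoc f (singleton : Fin n → Finset (Fin n)) ∅ a x, elim_snoc f (singleton : Fin m → Finset (Fin m)) ∅ b y] at this
    · obtain ⟨x, hx⟩ := h.symm.exists_elem y
      refine ⟨x, ?_⟩
      have := ih hx.symm (Fin.snoc (α := fun _ => Option (Fin (p + 1)))
        (fun i => (f i).map Fin.castSucc) (some (Fin.last p))) g
      rwa [elim_snoc f (singleton : Fin n → Finset (Fin n)) ∅ a x, elim_snoc f (singleton : Fin m → Finset (Fin m)) ∅ b y] at this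
    · have := ih (h.mono k.le_succ) (Fin.snoc (α := fun _ => Option (Fin p)) f none) g
      rwa [elim_snoc_none f (singleton : Fin n → Finset (Fin n)) ∅ a, elim_snoc_none f (singleton : Fin m → Finset (Fin m)) ∅ b] at this
    · obtain ⟨T, hT⟩ := h.exists_set S
      refine ⟨T, ?_⟩
      have := ih hT f (Fin.snoc (α := fun _ => Option (Fin (q + 1)))
        (fun i => (g i).map Fin.castSucc) (some (Fin.last q)))
      rwa [elim_snoc g id ∅ X S, elim_snoc g id ∅ Y T] at this
    · obtain ⟨S, hS⟩ := h.symm.exists_set T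
      refine ⟨S, ?_⟩
      have := ih hS.symm f (Fin.snoc (α := fun _ => Option (Fin (q + 1)))
        (fun i => (g i).map Fin.castSucc) (some (Fin.last q)))
      rwa [elim_snoc g id ∅ X S, elim_snoc g id ∅ Y T] at this

theorem Equivalent.chainWins_empty {n m k : ℕ} (h : Equivalent ltLang k (Fin n) (Fin m))
    (p q : ℕ) : ChainWins k (n := n) (m := m) (fun _ : Fin p => ∅) (fun _ : Fin q => ∅)
      (fun _ => ∅) (fun _ => ∅) :=
  have h' : EquivalentAt ltLang k (A := Fin n) (B := Fin m) Fin.elim0 Fin.elim0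
    Fin.elim0 Fin.elim0 := h
  h'.chainWins (fun _ => none) (fun _ => none)

/-- Nonemptiness of the answer is demanded because sizes are later compared up to a factor, which
would fail for an empty answer. -/
theorem Equivalent.exists_chainWins {n m k : ℕ} (h : Equivalent ltLang (k + 1) (Fin n) (Fin m))
    (p q : ℕ) (S : Finset (Fin n)) :
    ∃ T : Finset (Fin m), (S.Nonempty → T.Nonempty) ∧ ChainWins k (fun _ : Fin p => ∅)
      (Fin.snoc (α := fun _ => Finset (Fin n)) (fun _ : Fin q => ∅) S) (fun _ => ∅)
      (Fin.snoc (α := fun _ => Finset (Fin m)) (fun _ : Fin q => ∅) T) := by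
  have h : EquivalentAt ltLang (k + 1) (A := Fin n) (B := Fin m) Fin.elim0 Fin.elim0
    Fin.elim0 Fin.elim0 := h
  -- With no round left after the set move, rank 0 cannot express nonemptiness of the set. But as
  -- all element variables are empty, every `T` wins, and an element move supplies a singleton.
  rcases k with _ | k
  · by_cases hS : S.Nonempty
    · obtain ⟨x, -⟩ := hS
      obtain ⟨y, -⟩ := h.exists_elem x
      exact ⟨{y}, by simp, by simp [ChainWins]⟩
    · exact ⟨∅, fun h => absurd h hS, by simp [ChainWins]⟩
  · obtain ⟨T, hT⟩ := h.exists_set S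
    refine ⟨T, fun ⟨x, hx⟩ => ?_, ?_⟩
    -- With a round left, `∃ x, x ∈ X` has rank 1 and transfers nonemptiness.
    · obtain ⟨y, hy⟩ := (hT (.exElem (.mem (Fin.last 0) (Fin.last 0)))
        (by simp [Formula.rank])).1 ⟨x, by simpa only [Formula.Holds, Fin.snoc_last] using hx⟩
      exact ⟨y, by simpa only [Formula.Holds, Fin.snoc_last] using hy⟩
    · have := hT.chainWins (fun _ : Fin p => none)
        (Fin.snoc (α := fun _ => Option (Fin 1)) (fun _ : Fin q => none) (some (Fin.last 0)))
      have e := fun (r : ℕ) (S : Finset (Fin r)) =>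
        elim_snoc (fun _ : Fin q => none) id ∅ Fin.elim0 S
      simp only [Option.map_none, Option.elim_none] at e
      rwa [e, e] at this

end Chain

/-! ### Restricting finite sets along embeddings -/

section Restrict

variable {C A : Type}

/-- The part of a finite subset of `A` inside the image of `C`. -/
noncomputable def restr (f : C ↪ A) (S : Finset A) : Finset C := S.preimage f f.injective.injOn

@[simp] theorem mem_restr {f : C ↪ A} {S : Finset A} {x : C} : x ∈ restr f S ↔ f x ∈ S := by
  simp [restr]

@[simp] theorem restr_empty (f : C ↪ A) : restr f ∅ = ∅ := by
  ext; simp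

@[simp] theorem restr_singleton (f : C ↪ A) (x : C) : restr f {f x} = {x} := by
  ext; simp

theorem restr_singleton_eq_empty {f : C ↪ A} {y : A} (h : ∀ x, f x ≠ y) : restr f {y} = ∅ := by
  ext; simp [h]

theorem card_restr_le (f : C ↪ A) (S : Finset A) : (restr f S).card ≤ S.card := by
  rw [← Finset.card_map f]
  exact Finset.card_le_card fun y hy => by
    obtain ⟨x, hx, rfl⟩ := Finset.mem_map.1 hy
    exact mem_restr.1 hx

theorem restr_snoc (f : C ↪ A) {p : ℕ} (E : Fin p → Finset A) (S : Finset A) :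
    (fun s => restr f ((Fin.snoc (α := fun _ => Finset A) E S : Fin (p + 1) → Finset A) s)) =
      Fin.snoc (α := fun _ => Finset C) (fun s => restr f (E s)) (restr f S) := by
  funext s
  refine Fin.lastCases ?_ (fun s => ?_) s <;> simp

theorem snoc_const {M : Type} (p : ℕ) (d : M) :
    (Fin.snoc (α := fun _ => M) (fun _ : Fin p => d) d : Fin (p + 1) → M) = fun _ => d := by
  funext s
  refine Fin.lastCases ?_ (fun s => ?_) s <;> simp

end Restrict

/-! ### Splitting a triple-u into base nodes, left order and right order -/

namespace TripleU

variable {n m : ℕ}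

/-- The left order of a triple-u. -/
def leftEmb : Fin n ↪ TripleU n m := ⟨.left, fun _ _ h => by cases h; rfl⟩

/-- The right order of a triple-u. -/
def rightEmb : Fin m ↪ TripleU n m := ⟨.right, fun _ _ h => by cases h; rfl⟩

/-- The copy in a triple-u of a node of the triple-u with empty orders. -/
def base : TripleU 0 0 → TripleU n m
  | .l => .l | .r => .r | .a₁ => .a₁ | .a₂ => .a₂ | .b₁ => .b₁ | .b₂ => .b₂ | .b₃ => .b₃
  | .left i => i.elim0
  | .right i => i.elim0

/-- The seven nodes of a triple-u outside of its two orders. -/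
def baseEmb : TripleU 0 0 ↪ TripleU n m where
  toFun := base
  inj' x y h := by
    rcases x with _ | _ | _ | _ | _ | _ | _ | i | i <;>
    rcases y with _ | _ | _ | _ | _ | _ | _ | j | j <;>
    first | rfl | exact i.elim0 | exact j.elim0 | cases h

theorem leftEmb_apply (i : Fin n) : (leftEmb i : TripleU n m) = .left i := rfl

theorem rightEmb_apply (i : Fin m) : (rightEmb i : TripleU n m) = .right i := rfl

theorem baseEmb_apply (c : TripleU 0 0) : (baseEmb c : TripleU n m) = base c := rfl

@[simp] theorem leftEmb_ne_rightEmb (i : Fin n) (j : Fin m) :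
    (leftEmb i : TripleU n m) ≠ rightEmb j := by
  simp only [leftEmb_apply, rightEmb_apply]
  nofun

@[simp] theorem rightEmb_ne_leftEmb (i : Fin m) (j : Fin n) :
    (rightEmb i : TripleU n m) ≠ leftEmb j := by
  simp only [leftEmb_apply, rightEmb_apply]
  nofun

@[simp] theorem baseEmb_ne_leftEmb (c : TripleU 0 0) (j : Fin n) :
    (baseEmb c : TripleU n m) ≠ leftEmb j := by
  rcases c with _ | _ | _ | _ | _ | _ | _ | i | i <;> first | exact i.elim0 | (simp only [baseEmb_apply, leftEmb_apply, base]; nofun)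

@[simp] theorem leftEmb_ne_baseEmb (j : Fin n) (c : TripleU 0 0) :
    (leftEmb j : TripleU n m) ≠ baseEmb c := (baseEmb_ne_leftEmb c j).symm

@[simp] theorem baseEmb_ne_rightEmb (c : TripleU 0 0) (j : Fin m) :
    (baseEmb c : TripleU n m) ≠ rightEmb j := by
  rcases c with _ | _ | _ | _ | _ | _ | _ | i | i <;> first | exact i.elim0 | (simp only [baseEmb_apply, rightEmb_apply, base]; nofun)

@[simp] theorem rightEmb_ne_baseEmb (j : Fin m) (c : TripleU 0 0) :
    (rightEmb j : TripleU n m) ≠ baseEmb c := (baseEmb_ne_rightEmb c j).symm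

theorem cases_emb (x : TripleU n m) :
    (∃ c, x = baseEmb c) ∨ (∃ i, x = leftEmb i) ∨ ∃ i, x = rightEmb i := by
  rcases x with _ | _ | _ | _ | _ | _ | _ | i | i
  · exact .inl ⟨.l, rfl⟩
  · exact .inl ⟨.r, rfl⟩
  · exact .inl ⟨.a₁, rfl⟩
  · exact .inl ⟨.a₂, rfl⟩
  · exact .inl ⟨.b₁, rfl⟩
  · exact .inl ⟨.b₂, rfl⟩
  · exact .inl ⟨.b₃, rfl⟩
  · exact .inr (.inl ⟨i, rfl⟩)
  · exact .inr (.inr ⟨i, rfl⟩)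

theorem card_base_le (S : Finset (TripleU 0 0)) : S.card ≤ 7 := by
  classical
  refine (Finset.card_le_card (t := {.l, .r, .a₁, .a₂, .b₁, .b₂, .b₃}) fun x _ => ?_).trans
    ((Finset.card_insert_le _ _).trans (Nat.succ_le_succ Finset.card_le_six))
  rcases x with _ | _ | _ | _ | _ | _ | _ | i | i <;> first | exact i.elim0 | simp

theorem card_le (S : Finset (TripleU n m)) :
    S.card ≤ 7 + (restr leftEmb S).card + (restr rightEmb S).card := by
  classical
  have h : S ⊆ (restr baseEmb S).map baseEmb ∪ (restr leftEmb S).map leftEmb ∪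
      (restr rightEmb S).map rightEmb := by
    intro x hx
    rcases cases_emb x with ⟨c, rfl⟩ | ⟨c, rfl⟩ | ⟨c, rfl⟩ <;> simp [hx]
  refine (Finset.card_le_card h).trans ((Finset.card_union_le _ _).trans ?_)
  rw [Finset.card_map]
  gcongr
  refine (Finset.card_union_le _ _).trans ?_
  rw [Finset.card_map, Finset.card_map]
  gcongr
  exact card_base_le _

theorem card_le_length (S : Finset (TripleU n m)) : S.card ≤ 7 + n + m :=
  (card_le S).trans (by
    have h1 := Finset.card_le_univ (restr leftEmb S)
    have h2 := Finset.card_le_univ (restr rightEmb S)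
    rw [Fintype.card_fin] at h1 h2
    lia)

theorem exists_restr_eq (B : Finset (TripleU 0 0)) (L : Finset (Fin n)) (R : Finset (Fin m)) :
    ∃ T : Finset (TripleU n m), restr baseEmb T = B ∧ restr leftEmb T = L ∧
      restr rightEmb T = R := by
  classical
  refine ⟨B.map baseEmb ∪ L.map leftEmb ∪ R.map rightEmb, ?_, ?_, ?_⟩ <;> ext x <;> simp

theorem lt_leftEmb_iff {i j : Fin n} : (leftEmb i : TripleU n m).Lt (leftEmb j) ↔ i < j :=
  ⟨fun h => by cases h; assumption, .left_left⟩

theorem lt_rightEmb_iff {i j : Fin m} : (rightEmb i : TripleU n m).Lt (rightEmb j) ↔ i < j :=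
  ⟨fun h => by cases h; assumption, .right_right⟩

theorem not_lt_left_right (i : Fin n) (j : Fin m) :
    ¬ (leftEmb i : TripleU n m).Lt (rightEmb j) := by
  simp only [leftEmb_apply, rightEmb_apply]
  nofun

theorem not_lt_right_left (i : Fin m) (j : Fin n) :
    ¬ (rightEmb i : TripleU n m).Lt (leftEmb j) := by
  simp only [leftEmb_apply, rightEmb_apply]
  nofun

theorem lt_base_iff {n' m' : ℕ} {c d : TripleU 0 0} :
    (baseEmb c : TripleU n m).Lt (baseEmb d) ↔ (baseEmb c : TripleU n' m').Lt (baseEmb d) := by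
  rcases c with _ | _ | _ | _ | _ | _ | _ | i | i <;>
    rcases d with _ | _ | _ | _ | _ | _ | _ | j | j <;>
    first
    | exact i.elim0
    | exact j.elim0
    | simp only [baseEmb_apply, base]
      exact iff_of_true (by constructor) (by constructor)
    | simp only [baseEmb_apply, base]
      exact iff_of_false nofun nofun

theorem not_lt_base_left {c : TripleU 0 0} {i : Fin n} :
    ¬ (baseEmb c : TripleU n m).Lt (leftEmb i) := by
  rcases c with _ | _ | _ | _ | _ | _ | _ | i | i <;> first | exact i.elim0 | (simp only [baseEmb_apply, leftEmb_apply, base]; nofun)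

theorem not_lt_base_right {c : TripleU 0 0} {i : Fin m} :
    ¬ (baseEmb c : TripleU n m).Lt (rightEmb i) := by
  rcases c with _ | _ | _ | _ | _ | _ | _ | i | i <;> first | exact i.elim0 | (simp only [baseEmb_apply, rightEmb_apply, base]; nofun)

/-- Neither the place in the order nor its length matters, so independent answers on the parts fit
together. -/
theorem lt_left_base_iff {n' m' : ℕ} {c : TripleU 0 0} {i : Fin n} {j : Fin n'} :
    (leftEmb i : TripleU n m).Lt (baseEmb c) ↔ (leftEmb j : TripleU n' m').Lt (baseEmb c) := by
  rcases c with _ | _ | _ | _ | _ | _ | _ | i | i <;>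
    first
    | exact i.elim0
    | simp only [baseEmb_apply, leftEmb_apply, base]
      exact iff_of_true (by constructor) (by constructor)
    | simp only [baseEmb_apply, leftEmb_apply, base]
      exact iff_of_false nofun nofun

theorem lt_right_base_iff {n' m' : ℕ} {c : TripleU 0 0} {i : Fin m} {j : Fin m'} :
    (rightEmb i : TripleU n m).Lt (baseEmb c) ↔ (rightEmb j : TripleU n' m').Lt (baseEmb c) := by
  rcases c with _ | _ | _ | _ | _ | _ | _ | i | i <;>
    first
    | exact i.elim0
    | simp only [baseEmb_apply, rightEmb_apply, base]
      exact iff_of_true (by constructor) (by constructor)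
    | simp only [baseEmb_apply, rightEmb_apply, base]
      exact iff_of_false nofun nofun

theorem baseEmb_eq_l_iff {c : TripleU 0 0} : (baseEmb c : TripleU n m) = .l ↔ c = .l :=
  baseEmb.injective.eq_iff (b := .l)

theorem baseEmb_eq_r_iff {c : TripleU 0 0} : (baseEmb c : TripleU n m) = .r ↔ c = .r :=
  baseEmb.injective.eq_iff (b := .r)

theorem perp_iff {x y : TripleU n m} : x.Perp y ↔ (x = .l ∧ y = .r) ∨ (x = .r ∧ y = .l) := by
  constructor
  · rintro (_ | _) <;> simp
  · rintro (⟨rfl, rfl⟩ | ⟨rfl, rfl⟩) <;> constructor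

end TripleU

open TripleU

/-! ### The game on a pair of triple-u's -/

section Component

variable {n m n' m' : ℕ}

/-- Duplicator can answer on two triple-u's with `k` remaining set and element moves: the parts of
the position in the seven base nodes coincide, and duplicator wins on the left and on the right
orders. -/
structure ComponentWins (k : ℕ) {p q : ℕ} (E : Fin p → Finset (TripleU n m))
    (X : Fin q → Finset (TripleU n m)) (F : Fin p → Finset (TripleU n' m'))
    (Y : Fin q → Finset (TripleU n' m')) : Prop where
  base_elem : (fun s => restr baseEmb (E s)) = fun s => restr baseEmb (F s)
  base_set : (fun t => restr baseEmb (X t)) = fun t => restr baseEmb (Y t)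
  left : ChainWins k (fun s => restr leftEmb (E s)) (fun t => restr leftEmb (X t))
    (fun s => restr leftEmb (F s)) (fun t => restr leftEmb (Y t))
  right : ChainWins k (fun s => restr rightEmb (E s)) (fun t => restr rightEmb (X t))
    (fun s => restr rightEmb (F s)) (fun t => restr rightEmb (Y t))

namespace ComponentWins

variable {k p q : ℕ} {E : Fin p → Finset (TripleU n m)} {X : Fin q → Finset (TripleU n m)}
  {F : Fin p → Finset (TripleU n' m')} {Y : Fin q → Finset (TripleU n' m')}

theorem symm (h : ComponentWins k E X F Y) : ComponentWins k F Y E X :=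
  ⟨h.1.symm, h.2.symm, h.3.symm, h.4.symm⟩

/-- For a round in which the element is chosen outside of this triple-u. -/
theorem skip (h : ComponentWins (k + 1) E X F Y) :
    ComponentWins k (Fin.snoc (α := fun _ => Finset (TripleU n m)) E ∅) X
      (Fin.snoc (α := fun _ => Finset (TripleU n' m')) F ∅) Y := by
  constructor <;> try simp only [restr_snoc, restr_empty]
  · rw [h.base_elem]
  · exact h.base_set
  · exact h.left.2.2.1
  · exact h.right.2.2.1

theorem exists_elem (h : ComponentWins (k + 1) E X F Y) (x : TripleU n m) :
    ∃ y, ComponentWins k (Fin.snoc (α := fun _ => Finset (TripleU n m)) E {x}) X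
      (Fin.snoc (α := fun _ => Finset (TripleU n' m')) F {y}) Y := by
  rcases cases_emb x with ⟨c, rfl⟩ | ⟨i, rfl⟩ | ⟨i, rfl⟩
  · refine ⟨baseEmb c, ?_⟩
    constructor <;> try simp only [restr_snoc, restr_singleton]
    · rw [h.base_elem]
    · exact h.base_set
    · rw [restr_singleton_eq_empty (by simp), restr_singleton_eq_empty (by simp)]
      exact h.left.2.2.1
    · rw [restr_singleton_eq_empty (by simp), restr_singleton_eq_empty (by simp)]
      exact h.right.2.2.1
  · obtain ⟨j, hj⟩ := h.left.1 i
    refine ⟨leftEmb j, ?_⟩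
    constructor <;> try simp only [restr_snoc, restr_singleton]
    · rw [restr_singleton_eq_empty (by simp), restr_singleton_eq_empty (by simp), h.base_elem]
    · exact h.base_set
    · exact hj
    · rw [restr_singleton_eq_empty (by simp), restr_singleton_eq_empty (by simp)]
      exact h.right.2.2.1
  · obtain ⟨j, hj⟩ := h.right.1 i
    refine ⟨rightEmb j, ?_⟩
    constructor <;> try simp only [restr_snoc, restr_singleton]
    · rw [restr_singleton_eq_empty (by simp), restr_singleton_eq_empty (by simp), h.base_elem]
    · exact h.base_set
    · rw [restr_singleton_eq_empty (by simp), restr_singleton_eq_empty (by simp)]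
      exact h.left.2.2.1
    · exact hj

theorem exists_set (h : ComponentWins (k + 1) E X F Y) (S : Finset (TripleU n m)) :
    ∃ T, ComponentWins k E (Fin.snoc (α := fun _ => Finset (TripleU n m)) X S)
      F (Fin.snoc (α := fun _ => Finset (TripleU n' m')) Y T) := by
  obtain ⟨L, hL⟩ := h.left.2.2.2.1 (restr leftEmb S)
  obtain ⟨R, hR⟩ := h.right.2.2.2.1 (restr rightEmb S)
  obtain ⟨T, hTb, rfl, rfl⟩ := exists_restr_eq (restr baseEmb S) L R
  refine ⟨T, ?_⟩
  constructor <;> try simp only [restr_snoc]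
  · exact h.base_elem
  · rw [h.base_set, hTb]
  · exact hL
  · exact hR

/-- An element is answered by the same base node, or by a node of the same one of the two
orders. -/
theorem exists_corresponding (h : ComponentWins 0 E X F Y) {s : Fin p} {x : TripleU n m}
    (hx : E s = {x}) :
    (∃ c, x = baseEmb c ∧ baseEmb c ∈ F s) ∨ (∃ i j, x = leftEmb i ∧ leftEmb j ∈ F s) ∨
      ∃ i j, x = rightEmb i ∧ rightEmb j ∈ F s := by
  rcases cases_emb x with ⟨c, rfl⟩ | ⟨i, rfl⟩ | ⟨i, rfl⟩
  · have := congrFun h.base_elem s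
    rw [hx, restr_singleton] at this
    exact .inl ⟨c, rfl, mem_restr.1 (this ▸ Finset.mem_singleton_self c)⟩
  -- The equality clause for the pair `(s, s)` says that one side is nonempty iff the other is.
  · obtain ⟨j, hj, -⟩ := (h.left.2.1 s s).1 ⟨i, by simp [hx], by simp [hx]⟩
    exact .inr (.inl ⟨i, j, rfl, mem_restr.1 hj⟩)
  · obtain ⟨j, hj, -⟩ := (h.right.2.1 s s).1 ⟨i, by simp [hx], by simp [hx]⟩
    exact .inr (.inr ⟨i, j, rfl, mem_restr.1 hj⟩)

theorem exists_mem (h : ComponentWins 0 E X F Y) {s : Fin p} {x : TripleU n m}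
    (hx : E s = {x}) : (F s).Nonempty := by
  rcases h.exists_corresponding hx with ⟨c, -, h⟩ | ⟨-, j, -, h⟩ | ⟨-, j, -, h⟩ <;> exact ⟨_, h⟩

theorem cases (h : ComponentWins 0 E X F Y) {s : Fin p} {x : TripleU n m} {y : TripleU n' m'}
    (hx : E s = {x}) (hy : F s = {y}) :
    (∃ c, x = baseEmb c ∧ y = baseEmb c) ∨ (∃ i j, x = leftEmb i ∧ y = leftEmb j) ∨
      ∃ i j, x = rightEmb i ∧ y = rightEmb j := by
  simpa [hy, eq_comm] using h.exists_corresponding hx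

theorem mem_iff (h : ComponentWins 0 E X F Y) {s : Fin p} {x : TripleU n m} {y : TripleU n' m'}
    (hx : E s = {x}) (hy : F s = {y}) (t : Fin q) : x ∈ X t ↔ y ∈ Y t := by
  rcases h.cases hx hy with ⟨c, rfl, rfl⟩ | ⟨i, j, rfl, rfl⟩ | ⟨i, j, rfl, rfl⟩
  · simpa using Finset.ext_iff.1 (congrFun h.base_set t) c
  · simpa [hx, hy] using h.left.1 s t
  · simpa [hx, hy] using h.right.1 s t

theorem eq_l_iff (h : ComponentWins 0 E X F Y) {s : Fin p} {x : TripleU n m} {y : TripleU n' m'}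
    (hx : E s = {x}) (hy : F s = {y}) : x = .l ↔ y = .l := by
  rcases h.cases hx hy with ⟨c, rfl, rfl⟩ | ⟨i, j, rfl, rfl⟩ | ⟨i, j, rfl, rfl⟩
  · rw [baseEmb_eq_l_iff, baseEmb_eq_l_iff]
  · exact ⟨nofun, nofun⟩
  · exact ⟨nofun, nofun⟩

theorem eq_r_iff (h : ComponentWins 0 E X F Y) {s : Fin p} {x : TripleU n m} {y : TripleU n' m'}
    (hx : E s = {x}) (hy : F s = {y}) : x = .r ↔ y = .r := by
  rcases h.cases hx hy with ⟨c, rfl, rfl⟩ | ⟨i, j, rfl, rfl⟩ | ⟨i, j, rfl, rfl⟩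
  · rw [baseEmb_eq_r_iff, baseEmb_eq_r_iff]
  · exact ⟨nofun, nofun⟩
  · exact ⟨nofun, nofun⟩

section Pair

variable {s t : Fin p} {x x' : TripleU n m} {y y' : TripleU n' m'}

theorem eq_iff (h : ComponentWins 0 E X F Y) (hx : E s = {x}) (hy : F s = {y})
    (hx' : E t = {x'}) (hy' : F t = {y'}) : x = x' ↔ y = y' := by
  rcases h.cases hx hy with ⟨c, rfl, rfl⟩ | ⟨i, j, rfl, rfl⟩ | ⟨i, j, rfl, rfl⟩ <;>
    rcases h.cases hx' hy' with ⟨c', rfl, rfl⟩ | ⟨i', j', rfl, rfl⟩ | ⟨i', j', rfl, rfl⟩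
  any_goals simp
  · simpa [hx, hy, hx', hy'] using h.left.2.1 s t
  · simpa [hx, hy, hx', hy'] using h.right.2.1 s t

theorem lt_iff (h : ComponentWins 0 E X F Y) (hx : E s = {x}) (hy : F s = {y})
    (hx' : E t = {x'}) (hy' : F t = {y'}) : x.Lt x' ↔ y.Lt y' := by
  rcases h.cases hx hy with ⟨c, rfl, rfl⟩ | ⟨i, j, rfl, rfl⟩ | ⟨i, j, rfl, rfl⟩ <;>
    rcases h.cases hx' hy' with ⟨c', rfl, rfl⟩ | ⟨i', j', rfl, rfl⟩ | ⟨i', j', rfl, rfl⟩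
  · exact lt_base_iff
  · exact iff_of_false not_lt_base_left not_lt_base_left
  · exact iff_of_false not_lt_base_right not_lt_base_right
  · exact lt_left_base_iff
  · rw [lt_leftEmb_iff, lt_leftEmb_iff]
    simpa [hx, hy, hx', hy'] using h.left.2.2 s t
  · exact iff_of_false (not_lt_left_right _ _) (not_lt_left_right _ _)
  · exact lt_right_base_iff
  · exact iff_of_false (not_lt_right_left _ _) (not_lt_right_left _ _)
  · rw [lt_rightEmb_iff, lt_rightEmb_iff]
    simpa [hx, hy, hx', hy'] using h.right.2.2 s t

theorem perp_iff (h : ComponentWins 0 E X F Y) (hx : E s = {x}) (hy : F s = {y})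
    (hx' : E t = {x'}) (hy' : F t = {y'}) : x.Perp x' ↔ y.Perp y' := by
  rw [TripleU.perp_iff, TripleU.perp_iff, h.eq_l_iff hx hy, h.eq_r_iff hx hy, h.eq_l_iff hx' hy',
    h.eq_r_iff hx' hy']

end Pair

end ComponentWins

theorem componentWins_empty {k : ℕ} (hl : Equivalent ltLang k (Fin n) (Fin n'))
    (hr : Equivalent ltLang k (Fin m) (Fin m')) (p q : ℕ) :
    ComponentWins k (fun _ : Fin p => (∅ : Finset (TripleU n m))) (fun _ : Fin q => ∅)
      (fun _ => (∅ : Finset (TripleU n' m'))) (fun _ => ∅) := by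
  constructor <;> try simp only [restr_empty]
  · exact hl.chainWins_empty p q
  · exact hr.chainWins_empty p q

/-- The left orders being equal, duplicator copies the left part, which gives the size bound; only
the right part is answered through equivalence. -/
theorem exists_fresh_of_left {k : ℕ} (hl : n = n')
    (hr : Equivalent ltLang (k + 1) (Fin m) (Fin m')) (p q : ℕ) {S : Finset (TripleU n m)}
    (hS : S.Nonempty) :
    ∃ T : Finset (TripleU n' m'), T.Nonempty ∧ (restr leftEmb S).card ≤ T.card ∧
      ComponentWins k (fun _ : Fin p => ∅)
        (Fin.snoc (α := fun _ => Finset (TripleU n m)) (fun _ : Fin q => ∅) S)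
        (fun _ : Fin p => ∅)
        (Fin.snoc (α := fun _ => Finset (TripleU n' m')) (fun _ : Fin q => ∅) T) := by
  subst hl
  obtain ⟨R, hR0, hR⟩ := hr.exists_chainWins p q (restr rightEmb S)
  obtain ⟨T, hTb, hTl, rfl⟩ := exists_restr_eq (restr baseEmb S) (restr leftEmb S) R
  refine ⟨T, ?_, ?_, ?_⟩
  · obtain ⟨x, hx⟩ := hS
    rcases cases_emb x with ⟨c, rfl⟩ | ⟨i, rfl⟩ | ⟨i, rfl⟩
    · exact ⟨baseEmb c, by rwa [← mem_restr, hTb, mem_restr]⟩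
    · exact ⟨leftEmb i, by rwa [← mem_restr, hTl, mem_restr]⟩
    · obtain ⟨j, hj⟩ := hR0 ⟨i, by simpa⟩
      exact ⟨_, mem_restr.1 hj⟩
  · rw [← hTl]
    exact card_restr_le _ _
  · constructor <;> try simp only [restr_snoc, restr_empty, hTb, hTl]
    · exact ChainWins.refl _ _ _
    · exact hR

theorem exists_fresh_of_right {k : ℕ} (hl : Equivalent ltLang (k + 1) (Fin n) (Fin n'))
    (hr : m = m') (p q : ℕ) {S : Finset (TripleU n m)}
    (hS : S.Nonempty) :
    ∃ T : Finset (TripleU n' m'), T.Nonempty ∧ (restr rightEmb S).card ≤ T.card ∧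
      ComponentWins k (fun _ : Fin p => ∅)
        (Fin.snoc (α := fun _ => Finset (TripleU n m)) (fun _ : Fin q => ∅) S)
        (fun _ : Fin p => ∅)
        (Fin.snoc (α := fun _ => Finset (TripleU n' m')) (fun _ : Fin q => ∅) T) := by
  subst hr
  obtain ⟨R, hR0, hR⟩ := hl.exists_chainWins p q (restr leftEmb S)
  obtain ⟨T, hTb, rfl, hTr⟩ := exists_restr_eq (restr baseEmb S) R (restr rightEmb S)
  refine ⟨T, ?_, ?_, ?_⟩
  · obtain ⟨x, hx⟩ := hS
    rcases cases_emb x with ⟨c, rfl⟩ | ⟨i, rfl⟩ | ⟨i, rfl⟩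
    · exact ⟨baseEmb c, by rwa [← mem_restr, hTb, mem_restr]⟩
    · obtain ⟨j, hj⟩ := hR0 ⟨i, by simpa⟩
      exact ⟨_, mem_restr.1 hj⟩
    · exact ⟨rightEmb i, by rwa [← mem_restr, hTr, mem_restr]⟩
  · rw [← hTr]
    exact card_restr_le _ _
  · constructor <;> try simp only [restr_snoc, restr_empty, hTb, hTr]
    · exact hR
    · exact ChainWins.refl _ _ _

end Component

/-! ### Unions of triple-u's -/

section Union

/-- The inclusion of the triple-u with index `i` into a union of triple-u's. -/
def nodeEmb {ι : Type} {p q : ι → ℕ} (i : ι) : TripleU (p i) (q i) ↪ TripleUUnion ι p q :=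
  ⟨.node i, fun _ _ h => by cases h; rfl⟩

section Single

variable {ι : Type} {p q : ι → ℕ}

theorem nodeEmb_ne_final (i : ι) (x : TripleU (p i) (q i)) :
    (nodeEmb i x : TripleUUnion ι p q) ≠ .final := by
  simp [nodeEmb]

theorem index_eq_of_nodeEmb_eq {i j : ι} {x : TripleU (p i) (q i)} {y : TripleU (p j) (q j)}
    (h : (nodeEmb i x : TripleUUnion ι p q) = nodeEmb j y) : i = j :=
  (TripleUUnion.node.inj h).1

theorem cases_nodeEmb (x : TripleUUnion ι p q) : x = .final ∨ ∃ i y, x = nodeEmb i y := by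
  rcases x with ⟨i, y⟩ | _
  · exact .inr ⟨i, y, rfl⟩
  · exact .inl rfl

theorem lt_nodeEmb_iff {i : ι} {x y : TripleU (p i) (q i)} :
    TripleUUnion.Lt (nodeEmb i x : TripleUUnion ι p q) (nodeEmb i y) ↔ x.Lt y := by
  refine ⟨fun h => ?_, fun h => .inner i h⟩
  cases h
  assumption

theorem lt_final_iff {i : ι} {x : TripleU (p i) (q i)} :
    TripleUUnion.Lt (nodeEmb i x : TripleUUnion ι p q) .final ↔ x = .l := by
  refine ⟨fun h => ?_, ?_⟩
  · cases h
    rfl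
  · rintro rfl
    exact .toFinal i

theorem not_final_lt (x : TripleUUnion ι p q) : ¬ TripleUUnion.Lt .final x := nofun

theorem not_lt_of_ne {i j : ι} (hij : i ≠ j) (x : TripleU (p i) (q i)) (y : TripleU (p j) (q j)) :
    ¬ TripleUUnion.Lt (nodeEmb i x : TripleUUnion ι p q) (nodeEmb j y) := by
  intro h
  cases h
  exact hij rfl

theorem perp_nodeEmb_iff {i : ι} {x y : TripleU (p i) (q i)} :
    TripleUUnion.Perp (nodeEmb i x : TripleUUnion ι p q) (nodeEmb i y) ↔ x.Perp y := by
  refine ⟨fun h => ?_, fun h => .inner i h⟩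
  cases h
  assumption

theorem not_perp_final (x : TripleUUnion ι p q) : ¬ TripleUUnion.Perp x .final := nofun

theorem not_final_perp (x : TripleUUnion ι p q) : ¬ TripleUUnion.Perp .final x := nofun

theorem not_perp_of_ne {i j : ι} (hij : i ≠ j) (x : TripleU (p i) (q i))
    (y : TripleU (p j) (q j)) :
    ¬ TripleUUnion.Perp (nodeEmb i x : TripleUUnion ι p q) (nodeEmb j y) := by
  intro h
  cases h
  exact hij rfl

theorem restr_nodeEmb_final (i : ι) :
    restr (nodeEmb i) ({.final} : Finset (TripleUUnion ι p q)) = ∅ :=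
  restr_singleton_eq_empty (nodeEmb_ne_final i)

theorem restr_nodeEmb_of_ne {i j : ι} (hij : i ≠ j) (x : TripleU (p j) (q j)) :
    restr (nodeEmb i) ({nodeEmb j x} : Finset (TripleUUnion ι p q)) = ∅ :=
  restr_singleton_eq_empty fun _ h => hij (index_eq_of_nodeEmb_eq h)

theorem restr_singleton_snoc (i : ι) {s : ℕ} (a : Fin s → TripleUUnion ι p q)
    (x : TripleUUnion ι p q) :
    (fun r => restr (nodeEmb i)
      {(Fin.snoc (α := fun _ => TripleUUnion ι p q) a x : Fin (s + 1) → _) r}) =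
      Fin.snoc (α := fun _ => Finset (TripleU (p i) (q i)))
        (fun r => restr (nodeEmb i) {a r}) (restr (nodeEmb i) {x}) := by
  funext r
  refine Fin.lastCases ?_ (fun r => ?_) r <;> simp

theorem exists_restr_nodeEmb_eq {J : Type} [Finite J] {v : J → ι} (hv : Function.Injective v)
    (T : ∀ j, Finset (TripleU (p (v j)) (q (v j)))) (P : Prop) :
    ∃ S : Finset (TripleUUnion ι p q), (.final ∈ S ↔ P) ∧ (∀ j, restr (nodeEmb (v j)) S = T j) ∧
      ∀ i ∉ Set.range v, restr (nodeEmb i) S = ∅ := by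
  classical
  have := Fintype.ofFinite J
  refine ⟨(if P then {.final} else ∅) ∪
    Finset.univ.biUnion fun j => (T j).map (nodeEmb (v j)), ?_, fun j => ?_, fun i hi => ?_⟩
  · split_ifs with hP <;> simp [hP, nodeEmb_ne_final]
  · ext x
    have h1 : (nodeEmb (v j) x : TripleUUnion ι p q) ∉
        (if P then {.final} else ∅ : Finset (TripleUUnion ι p q)) := by
      split_ifs <;> simp [nodeEmb_ne_final]
    simp only [mem_restr, Finset.mem_union, h1, false_or, Finset.mem_biUnion, Finset.mem_univ,
      true_and, Finset.mem_map]
    refine ⟨fun ⟨j', y, hy, h⟩ => ?_, fun h => ⟨j, x, h, rfl⟩⟩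
    obtain rfl := hv (index_eq_of_nodeEmb_eq h)
    rwa [← (nodeEmb (v j')).injective h]
  · ext x
    have h1 : (nodeEmb i x : TripleUUnion ι p q) ∉
        (if P then {.final} else ∅ : Finset (TripleUUnion ι p q)) := by
      split_ifs <;> simp [nodeEmb_ne_final]
    simp only [mem_restr, Finset.mem_union, h1, false_or, Finset.mem_biUnion, Finset.mem_univ,
      true_and, Finset.mem_map, Finset.notMem_empty, iff_false]
    rintro ⟨j, y, -, h⟩
    exact hi ⟨j, index_eq_of_nodeEmb_eq h⟩

theorem card_le_sum_restr {J : Type} [Fintype J] {u : J → ι} {S : Finset (TripleUUnion ι p q)}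
    (hS : ∀ i ∉ Set.range u, restr (nodeEmb i) S = ∅) :
    S.card ≤ 1 + ∑ j, (restr (nodeEmb (u j)) S).card := by
  classical
  have h : S ⊆ {.final} ∪ Finset.univ.biUnion
      fun j => (restr (nodeEmb (u j)) S).map (nodeEmb (u j)) := by
    intro x hx
    rcases cases_nodeEmb x with rfl | ⟨i, y, rfl⟩
    · simp
    · by_cases hi : i ∈ Set.range u
      · obtain ⟨j, rfl⟩ := hi
        exact Finset.mem_union_right _ (Finset.mem_biUnion.2 ⟨j, Finset.mem_univ j,
          Finset.mem_map_of_mem _ (mem_restr.2 hx)⟩)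
      · exact absurd (mem_restr.2 hx) (by simp [hS i hi])
  refine (Finset.card_le_card h).trans ((Finset.card_union_le _ _).trans ?_)
  rw [Finset.card_singleton]
  gcongr
  refine Finset.card_biUnion_le.trans (le_of_eq ?_)
  simp

theorem sum_card_restr_le {J : Type} [Fintype J] {v : J → ι} (hv : Function.Injective v)
    (T : Finset (TripleUUnion ι p q)) : ∑ j, (restr (nodeEmb (v j)) T).card ≤ T.card := by
  classical
  have h : Finset.univ.biUnion (fun j => (restr (nodeEmb (v j)) T).map (nodeEmb (v j))) ⊆ T := by
    intro x hx
    simp only [Finset.mem_biUnion, Finset.mem_univ, true_and, Finset.mem_map, mem_restr] at hx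
    obtain ⟨j, y, hy, rfl⟩ := hx
    exact hy
  refine le_trans (le_of_eq ?_) (Finset.card_le_card h)
  rw [Finset.card_biUnion]
  · simp
  · intro j _ j' _ hj
    refine Finset.disjoint_left.2 fun x hx hx' => hj (hv ?_)
    obtain ⟨y, -, rfl⟩ := Finset.mem_map.1 hx
    obtain ⟨y', -, h⟩ := Finset.mem_map.1 hx'
    exact (index_eq_of_nodeEmb_eq h).symm

end Single

/-- Greedy choice: the values chosen so far join the finite set to be avoided. -/
theorem exists_injective_avoiding {α β : Type} [Finite α] {R : α → β → Prop}
    (h : ∀ a (F : Set β), F.Finite → ∃ b ∉ F, R a b) {F : Set β} (hF : F.Finite) :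
    ∃ g : α → β, Function.Injective g ∧ ∀ a, g a ∉ F ∧ R a (g a) := by
  classical
  have := Fintype.ofFinite α
  suffices H : ∀ I : Finset α, ∃ g : α → β, Set.InjOn g I ∧ ∀ a ∈ I, g a ∉ F ∧ R a (g a) by
    obtain ⟨g, h1, h2⟩ := H Finset.univ
    exact ⟨g, by simpa [Set.injOn_univ] using h1, fun a => h2 a (Finset.mem_univ a)⟩
  intro I
  induction I using Finset.induction_on with
  | empty =>
    choose g _ using fun a => h a ∅ Set.finite_empty
    exact ⟨g, by simp, by simp⟩
  | insert a I ha ih =>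
    obtain ⟨g, h1, h2⟩ := ih
    obtain ⟨b, hb, hR⟩ := h a (F ∪ g '' I) (hF.union (I.finite_toSet.image g))
    have hg : ∀ x ∈ I, Function.update g a b x = g x := fun x hx =>
      Function.update_of_ne (by rintro rfl; exact ha hx) _ _
    refine ⟨Function.update g a b, ?_, ?_⟩
    · rw [Finset.coe_insert, Set.injOn_insert (by simpa using ha)]
      refine ⟨fun x hx y hy hxy => h1 hx hy (by rwa [hg x hx, hg y hy] at hxy), ?_⟩
      rintro ⟨x, hx, hxb⟩
      rw [hg x hx, Function.update_self] at hxb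
      exact hb (.inr ⟨x, hx, hxb⟩)
    · intro x hx
      rcases Finset.mem_insert.1 hx with rfl | hx
      · rw [Function.update_self]
        exact ⟨fun h => hb (.inl h), hR⟩
      · rw [hg x hx]
        exact h2 x hx

/-! ### Finite matchings as duplicator's invariant -/

variable {ι ι' : Type} {p q : ι → ℕ} {p' q' : ι' → ℕ}

/-- The answers of duplicator in untouched triple-u's: every triple-u of the first union is
equivalent to triple-u's of the second union outside of any given finite set, and every set in it
has an answer, in one of these triple-u's, that is at most `c` times smaller. -/
structure FreshAnswers (K c : ℕ) (p q : ι → ℕ) (p' q' : ι' → ℕ) : Prop where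
  empty : ∀ k ≤ K, ∀ (s t : ℕ) (i : ι) (F : Set ι'), F.Finite → ∃ i' ∉ F,
    ComponentWins k (fun _ : Fin s => (∅ : Finset (TripleU (p i) (q i)))) (fun _ : Fin t => ∅)
      (fun _ => (∅ : Finset (TripleU (p' i') (q' i')))) (fun _ => ∅)
  set : ∀ k < K, ∀ (s t : ℕ) (i : ι) (S : Finset (TripleU (p i) (q i))), S.Nonempty →
    ∀ F : Set ι', F.Finite → ∃ i' ∉ F, ∃ T : Finset (TripleU (p' i') (q' i')),
      S.card ≤ c * T.card ∧ ComponentWins k (fun _ : Fin s => ∅)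
        (Fin.snoc (α := fun _ => Finset (TripleU (p i) (q i))) (fun _ : Fin t => ∅) S)
        (fun _ : Fin s => ∅)
        (Fin.snoc (α := fun _ => Finset (TripleU (p' i') (q' i'))) (fun _ : Fin t => ∅) T)

/-- Outside of the triple-u's `u j` and `v j` the position is empty, and for every `j` duplicator
wins on the triple-u's `u j` and `v j`. -/
structure Matched (k : ℕ) {J : Type} (u : J → ι) (v : J → ι') {s t : ℕ}
    (a : Fin s → TripleUUnion ι p q) (X : Fin t → Finset (TripleUUnion ι p q))
    (b : Fin s → TripleUUnion ι' p' q') (Y : Fin t → Finset (TripleUUnion ι' p' q')) : Prop where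
  elem_left : ∀ i ∉ Set.range u, (fun r => restr (nodeEmb i) {a r}) = fun _ => ∅
  set_left : ∀ i ∉ Set.range u, (fun r => restr (nodeEmb i) (X r)) = fun _ => ∅
  elem_right : ∀ i ∉ Set.range v, (fun r => restr (nodeEmb i) {b r}) = fun _ => ∅
  set_right : ∀ i ∉ Set.range v, (fun r => restr (nodeEmb i) (Y r)) = fun _ => ∅
  final_elem : ∀ r, a r = .final ↔ b r = .final
  final_set : ∀ r, .final ∈ X r ↔ .final ∈ Y r
  component : ∀ j, ComponentWins k (fun r => restr (nodeEmb (u j)) {a r})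
    (fun r => restr (nodeEmb (u j)) (X r)) (fun r => restr (nodeEmb (v j)) {b r})
    (fun r => restr (nodeEmb (v j)) (Y r))

/-- Some finite matching of the triple-u's is winning for duplicator. -/
def ExistsMatching (k : ℕ) {s t : ℕ}
    (a : Fin s → TripleUUnion ι p q) (X : Fin t → Finset (TripleUUnion ι p q))
    (b : Fin s → TripleUUnion ι' p' q') (Y : Fin t → Finset (TripleUUnion ι' p' q')) : Prop :=
  ∃ (J : Type) (_ : Finite J) (u : J → ι) (v : J → ι'), Function.Injective u ∧
    Function.Injective v ∧ Matched k u v a X b Y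

variable {k s t : ℕ} {a : Fin s → TripleUUnion ι p q} {X : Fin t → Finset (TripleUUnion ι p q)}
    {b : Fin s → TripleUUnion ι' p' q'} {Y : Fin t → Finset (TripleUUnion ι' p' q')}

theorem ExistsMatching.symm (h : ExistsMatching k a X b Y) : ExistsMatching k b Y a X := by
  obtain ⟨J, hJ, u, v, hu, hv, h⟩ := h
  exact ⟨J, hJ, v, u, hv, hu, h.3, h.4, h.1, h.2, fun r => (h.5 r).symm, fun r => (h.6 r).symm,
    fun j => (h.7 j).symm⟩

section Final

variable {J : Type} {u : J → ι} {v : J → ι'}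

theorem Matched.cases (h : Matched 0 u v a X b Y) (r : Fin s) :
    (a r = .final ∧ b r = .final) ∨ ∃ j x y, a r = nodeEmb (u j) x ∧ b r = nodeEmb (v j) y := by
  rcases cases_nodeEmb (a r) with ha | ⟨i, x, ha⟩
  · exact .inl ⟨ha, (h.final_elem r).1 ha⟩
  · have hi : i ∈ Set.range u := by
      by_contra hi
      have := congrFun (h.elem_left i hi) r
      simp [ha] at this
    obtain ⟨j, rfl⟩ := hi
    obtain ⟨y, hy⟩ := (h.component j).exists_mem (s := r) (x := x) (by simp [ha])
    exact .inr ⟨j, x, y, ha, by simpa [eq_comm] using hy⟩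

/-- Distinct triple-u's are unrelated, and injectivity of `u` and `v` makes being in the same
triple-u agree on both sides; edges to `final` start only in nodes `l`, which correspond. -/
theorem Matched.finalWin (hu : Function.Injective u) (hv : Function.Injective v)
    (h : Matched 0 u v a X b Y) : FinalWin ltPerpLang a X b Y := by
  have hE : ∀ {r j x}, a r = nodeEmb (u j) x → restr (nodeEmb (u j)) {a r} = {x} :=
    fun h => by rw [h, restr_singleton]
  have hF : ∀ {r j x}, b r = nodeEmb (v j) x → restr (nodeEmb (v j)) {b r} = {x} :=
    fun h => by rw [h, restr_singleton]
  refine ⟨fun r o => ?_, fun r o => ?_, fun m R w => ?_⟩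
  · rcases h.cases r with ⟨ha, hb⟩ | ⟨j, x, y, ha, hb⟩
    · rw [ha, hb]
      exact h.final_set o
    · rw [ha, hb]
      simpa using (h.component j).mem_iff (hE ha) (hF hb) o
  · rcases h.cases r with ⟨ha, hb⟩ | ⟨j, x, y, ha, hb⟩ <;>
      rcases h.cases o with ⟨ha', hb'⟩ | ⟨j', x', y', ha', hb'⟩
    · simp [ha, hb, ha', hb']
    · rw [ha, hb, ha', hb']
      exact iff_of_false (nodeEmb_ne_final _ _).symm (nodeEmb_ne_final _ _).symm
    · rw [ha, hb, ha', hb']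
      exact iff_of_false (nodeEmb_ne_final _ _) (nodeEmb_ne_final _ _)
    · by_cases hj : j = j'
      · subst hj
        have := (h.component j).eq_iff (hE ha) (hF hb) (hE ha') (hF hb')
        rw [ha, hb, ha', hb', (nodeEmb (u j)).injective.eq_iff, (nodeEmb (v j)).injective.eq_iff,
          this]
      · rw [ha, hb, ha', hb']
        exact iff_of_false (fun e => hj (hu (index_eq_of_nodeEmb_eq e)))
          (fun e => hj (hv (index_eq_of_nodeEmb_eq e)))
  · cases R with
    | lt =>
      change TripleUUnion.Lt (a (w 0)) (a (w 1)) ↔ TripleUUnion.Lt (b (w 0)) (b (w 1))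
      rcases h.cases (w 0) with ⟨ha, hb⟩ | ⟨j, x, y, ha, hb⟩
      · rw [ha, hb]
        exact iff_of_false (not_final_lt _) (not_final_lt _)
      rcases h.cases (w 1) with ⟨ha', hb'⟩ | ⟨j', x', y', ha', hb'⟩
      · rw [ha, hb, ha', hb', lt_final_iff, lt_final_iff]
        exact (h.component j).eq_l_iff (hE ha) (hF hb)
      by_cases hj : j = j'
      · subst hj
        have := (h.component j).lt_iff (hE ha) (hF hb) (hE ha') (hF hb')
        rw [ha, hb, ha', hb', lt_nodeEmb_iff, lt_nodeEmb_iff, this]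
      · rw [ha, hb, ha', hb']
        exact iff_of_false (not_lt_of_ne (hu.ne hj) _ _) (not_lt_of_ne (hv.ne hj) _ _)
    | perp =>
      change TripleUUnion.Perp (a (w 0)) (a (w 1)) ↔ TripleUUnion.Perp (b (w 0)) (b (w 1))
      rcases h.cases (w 0) with ⟨ha, hb⟩ | ⟨j, x, y, ha, hb⟩
      · rw [ha, hb]
        exact iff_of_false (not_final_perp _) (not_final_perp _)
      rcases h.cases (w 1) with ⟨ha', hb'⟩ | ⟨j', x', y', ha', hb'⟩
      · rw [ha', hb']
        exact iff_of_false (not_perp_final _) (not_perp_final _)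
      by_cases hj : j = j'
      · subst hj
        have := (h.component j).perp_iff (hE ha) (hF hb) (hE ha') (hF hb')
        rw [ha, hb, ha', hb', perp_nodeEmb_iff, perp_nodeEmb_iff, this]
      · rw [ha, hb, ha', hb']
        exact iff_of_false (not_perp_of_ne (hu.ne hj) _ _) (not_perp_of_ne (hv.ne hj) _ _)

end Final

/-- An unmatched triple-u carries an empty position, so it can be paired with a fresh equivalent one
before spoiler's element in it is answered. -/
theorem ExistsMatching.exists_covering {K c : ℕ} (H : FreshAnswers K c p q p' q') (hk : k ≤ K)
    (h : ExistsMatching k a X b Y) (i : ι) :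
    ∃ (J : Type) (_ : Finite J) (u : J → ι) (v : J → ι'), Function.Injective u ∧
      Function.Injective v ∧ Matched k u v a X b Y ∧ i ∈ Set.range u := by
  obtain ⟨J, hJ, u, v, hu, hv, h⟩ := h
  by_cases hi : i ∈ Set.range u
  · exact ⟨J, hJ, u, v, hu, hv, h, hi⟩
  obtain ⟨i', hi', hw⟩ := H.empty k hk s t i (Set.range v) (Set.finite_range v)
  refine ⟨J ⊕ Unit, inferInstance, Sum.elim u fun _ => i, Sum.elim v fun _ => i',
    hu.sumElim (Function.injective_of_subsingleton _) fun j _ e => hi ⟨j, e⟩,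
    hv.sumElim (Function.injective_of_subsingleton _) fun j _ e => hi' ⟨j, e⟩, ?_,
    ⟨.inr (), rfl⟩⟩
  have hl : ∀ l, l ∉ Set.range (Sum.elim u fun _ : Unit => i) → l ∉ Set.range u :=
    fun l hl ⟨j, e⟩ => hl ⟨.inl j, e⟩
  have hr : ∀ l, l ∉ Set.range (Sum.elim v fun _ : Unit => i') → l ∉ Set.range v :=
    fun l hl ⟨j, e⟩ => hl ⟨.inl j, e⟩
  refine ⟨fun l h' => h.elem_left l (hl l h'), fun l h' => h.set_left l (hl l h'),
    fun l h' => h.elem_right l (hr l h'), fun l h' => h.set_right l (hr l h'),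
    h.final_elem, h.final_set, ?_⟩
  rintro (j | _)
  · exact h.component j
  · have := h.elem_left i hi
    have := h.set_left i hi
    have := h.elem_right i' hi'
    have := h.set_right i' hi'
    simp only [Sum.elim_inr, *]

theorem ExistsMatching.exists_elem {K c : ℕ} (H : FreshAnswers K c p q p' q') (hk : k + 1 ≤ K)
    (h : ExistsMatching (k + 1) a X b Y) (x : TripleUUnion ι p q) :
    ∃ y, ExistsMatching k (Fin.snoc (α := fun _ => TripleUUnion ι p q) a x) X
      (Fin.snoc (α := fun _ => TripleUUnion ι' p' q') b y) Y := by
  rcases cases_nodeEmb x with rfl | ⟨i, x, rfl⟩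
  · obtain ⟨J, hJ, u, v, hu, hv, h⟩ := h
    refine ⟨.final, J, hJ, u, v, hu, hv, fun i hi => ?_, h.set_left, fun i hi => ?_, h.set_right,
      fun r => ?_, h.final_set, fun j => ?_⟩
    · rw [restr_singleton_snoc, h.elem_left i hi, restr_nodeEmb_final, snoc_const]
    · rw [restr_singleton_snoc, h.elem_right i hi, restr_nodeEmb_final, snoc_const]
    · refine Fin.lastCases ?_ (fun r => ?_) r
      · simp
      · simpa using h.final_elem r
    · rw [restr_singleton_snoc, restr_singleton_snoc, restr_nodeEmb_final, restr_nodeEmb_final]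
      exact (h.component j).skip
  · obtain ⟨J, hJ, u, v, hu, hv, h, j, rfl⟩ := h.exists_covering H hk i
    obtain ⟨y, hy⟩ := (h.component j).exists_elem x
    refine ⟨nodeEmb (v j) y, J, hJ, u, v, hu, hv, fun i hi => ?_, h.set_left, fun i hi => ?_,
      h.set_right, fun r => ?_, h.final_set, fun j' => ?_⟩
    · rw [restr_singleton_snoc, h.elem_left i hi, restr_nodeEmb_of_ne (fun e => hi ⟨j, e.symm⟩),
        snoc_const]
    · rw [restr_singleton_snoc, h.elem_right i hi, restr_nodeEmb_of_ne (fun e => hi ⟨j, e.symm⟩),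
        snoc_const]
    · refine Fin.lastCases ?_ (fun r => ?_) r
      · simp [nodeEmb_ne_final]
      · simpa using h.final_elem r
    · rw [restr_singleton_snoc, restr_singleton_snoc]
      by_cases hj : j' = j
      · subst hj
        rwa [restr_singleton, restr_singleton]
      · rw [restr_nodeEmb_of_ne (hu.ne hj), restr_nodeEmb_of_ne (hv.ne hj)]
        exact (h.component j').skip

/-- `N` precedes `S`: it depends only on the current matching, as the bound move requires. -/
theorem ExistsMatching.exists_set {K c : ℕ} (H : FreshAnswers K c p q p' q') (hk : k + 1 ≤ K)
    (h : ExistsMatching (k + 1) a X b Y) :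
    ∃ N, ∀ S : Finset (TripleUUnion ι p q), ∃ T : Finset (TripleUUnion ι' p' q'),
      S.card ≤ N + c * T.card ∧
      ExistsMatching k a (Fin.snoc (α := fun _ => Finset (TripleUUnion ι p q)) X S)
        b (Fin.snoc (α := fun _ => Finset (TripleUUnion ι' p' q')) Y T) := by
  classical
  obtain ⟨J, hJ, u, v, hu, hv, h⟩ := h
  have := Fintype.ofFinite J
  -- The number of nodes in the matched triple-u's, plus one for `final`.
  refine ⟨1 + ∑ j, (7 + p (u j) + q (u j)), fun S => ?_⟩
  -- The triple-u's touched by `S` for the first time; there are finitely many, and they get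
  -- distinct fresh partners `g`.
  let α := {i : ι // i ∉ Set.range u ∧ (restr (nodeEmb i) S).Nonempty}
  have hα : Finite α := by
    have hx : ∀ i : α, ∃ x : S, ∃ y, x.1 = nodeEmb i.1 y :=
      fun ⟨i, _, y, hy⟩ => ⟨⟨_, mem_restr.1 hy⟩, y, rfl⟩
    choose f y hf using hx
    refine Finite.of_injective f fun i i' e => Subtype.ext (index_eq_of_nodeEmb_eq
      (p := p) (q := q) (x := y i) (y := y i') ?_)
    rw [← hf, ← hf, e]
  have := Fintype.ofFinite α
  obtain ⟨g, hg, hg'⟩ := exists_injective_avoiding (α := α)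
    (fun i => H.set k hk s t i.1 (restr (nodeEmb i.1) S) i.2.2) (Set.finite_range v)
  let u' : J ⊕ α → ι := Sum.elim u Subtype.val
  let v' : J ⊕ α → ι' := Sum.elim v g
  have hu' : Function.Injective u' :=
    hu.sumElim Subtype.val_injective fun j i e => i.2.1 ⟨j, e⟩
  have hv' : Function.Injective v' := hv.sumElim hg fun j i e => (hg' i).1 ⟨j, e⟩
  -- Matched triple-u's pay the additive term, new ones only the factor `c`.
  have hans : ∀ j, ∃ T : Finset (TripleU (p' (v' j)) (q' (v' j))),
      (restr (nodeEmb (u' j)) S).card ≤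
        Sum.elim (fun j => 7 + p (u j) + q (u j)) (fun _ => 0) j + c * T.card ∧
      ComponentWins k (fun r => restr (nodeEmb (u' j)) {a r})
        (Fin.snoc (α := fun _ => Finset (TripleU (p (u' j)) (q (u' j))))
          (fun r => restr (nodeEmb (u' j)) (X r)) (restr (nodeEmb (u' j)) S))
        (fun r => restr (nodeEmb (v' j)) {b r})
        (Fin.snoc (α := fun _ => Finset (TripleU (p' (v' j)) (q' (v' j))))
          (fun r => restr (nodeEmb (v' j)) (Y r)) T) := by
    rintro (j | i)
    · obtain ⟨T, hT⟩ := (h.component j).exists_set (restr (nodeEmb (u j)) S)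
      exact ⟨T, (card_le_length _).trans (Nat.le_add_right _ _), hT⟩
    · obtain ⟨hi, T, hc, hT⟩ := hg' i
      refine ⟨T, hc.trans (Nat.le_add_left _ _), ?_⟩
      have h1 := h.elem_left i.1 i.2.1
      have h2 := h.set_left i.1 i.2.1
      have h3 := h.elem_right (g i) hi
      have h4 := h.set_right (g i) hi
      simpa only [u', v', Sum.elim_inr, h1, h2, h3, h4] using hT
  choose T' hc hT' using hans
  obtain ⟨T, hT0, hT, hTr⟩ := exists_restr_nodeEmb_eq (p := p') (q := q') hv' T' (.final ∈ S)
  have hSl : ∀ i ∉ Set.range u', restr (nodeEmb i) S = ∅ := by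
    intro i hi
    by_contra hS
    exact hi ⟨.inr ⟨i, fun ⟨j, e⟩ => hi ⟨.inl j, e⟩, Finset.nonempty_iff_ne_empty.2 hS⟩, rfl⟩
  have hl : ∀ l, l ∉ Set.range u' → l ∉ Set.range u := fun l hl ⟨j, e⟩ => hl ⟨.inl j, e⟩
  have hr : ∀ l, l ∉ Set.range v' → l ∉ Set.range v := fun l hl ⟨j, e⟩ => hl ⟨.inl j, e⟩
  refine ⟨T, ?_, J ⊕ α, inferInstance, u', v', hu', hv', fun i hi => h.elem_left i (hl i hi),
    fun i hi => ?_, fun i hi => h.elem_right i (hr i hi), fun i hi => ?_, h.final_elem,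
    fun r => ?_, fun j => ?_⟩
  · calc S.card ≤ 1 + ∑ j, (restr (nodeEmb (u' j)) S).card := card_le_sum_restr hSl
      _ ≤ 1 + ∑ j, (Sum.elim (fun j => 7 + p (u j) + q (u j)) (fun _ => 0) j +
            c * (T' j).card) := by
          gcongr with j
          exact hc j
      _ = 1 + ∑ j, (7 + p (u j) + q (u j)) + c * ∑ j, (restr (nodeEmb (v' j)) T).card := by
          rw [Finset.sum_add_distrib, Fintype.sum_sum_type, Finset.mul_sum]
          simp [hT, add_assoc]
      _ ≤ _ := by
          gcongr
          exact sum_card_restr_le hv' T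
  · rw [restr_snoc, h.set_left i (hl i hi), hSl i hi, snoc_const]
  · rw [restr_snoc, h.set_right i (hr i hi), hTr i hi, snoc_const]
  · refine Fin.lastCases ?_ (fun r => ?_) r
    · simpa using hT0.symm
    · simpa using h.final_set r
  · rw [restr_snoc, restr_snoc, hT]
    exact hT' j

theorem ExistsMatching.duplicatorWins {K c : ℕ} (H : FreshAnswers K c p q p' q')
    (H' : FreshAnswers K c p' q' p q) (hk : k ≤ K) (h : ExistsMatching k a X b Y) :
    DuplicatorWins ltPerpLang k a X b Y := by
  induction k generalizing s t with
  | zero =>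
    obtain ⟨J, hJ, u, v, hu, hv, h⟩ := h
    exact h.finalWin hu hv
  | succ k ih =>
    have ih' := fun {s t : ℕ} {a : Fin s → TripleUUnion ι p q} {X : Fin t → _}
      {b : Fin s → TripleUUnion ι' p' q'} {Y : Fin t → _}
      (h : ExistsMatching k a X b Y) => ih (k.le_succ.trans hk) h
    obtain ⟨N, hN⟩ := h.exists_set H hk
    obtain ⟨N', hN'⟩ := h.symm.exists_set H' hk
    -- An answer with fewer than `l` elements would force `S.card ≤ N + c * l`, below this bound.
    refine ⟨fun x => ?_, fun y => ?_, fun S => ?_, fun T => ?_, fun l => ⟨N + c * l + 1, ?_⟩,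
      fun l => ⟨N' + c * l + 1, ?_⟩⟩
    · exact (h.exists_elem H hk x).imp fun _ h => ih' h
    · exact (h.symm.exists_elem H' hk y).imp fun _ h => ih' h.symm
    · exact (hN S).imp fun _ h => ih' h.2
    · exact (hN' T).imp fun _ h => ih' h.2.symm
    · intro S hS
      obtain ⟨T, hT, h⟩ := hN S
      refine ⟨T, ?_, ih' h⟩
      by_contra! hl
      have := Nat.mul_le_mul_left c hl.le
      lia
    · intro T hT
      obtain ⟨S, hS, h⟩ := hN' T
      refine ⟨S, ?_, ih' h.symm⟩
      by_contra! hl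
      have := Nat.mul_le_mul_left c hl.le
      lia

theorem existsMatching_empty (k : ℕ) :
    ExistsMatching k (p := p) (q := q) (p' := p') (q' := q') Fin.elim0 Fin.elim0 Fin.elim0
      Fin.elim0 :=
  ⟨Empty, inferInstance, Empty.elim, Empty.elim, fun j => j.elim, fun j => j.elim,
    fun _ _ => funext fun r => r.elim0, fun _ _ => funext fun r => r.elim0,
    fun _ _ => funext fun r => r.elim0, fun _ _ => funext fun r => r.elim0,
    fun r => r.elim0, fun r => r.elim0, fun j => j.elim⟩

end Union

theorem Equivalent.mono {L : FirstOrder.Language.{0, 0}} {k k' : ℕ} {A B : Type} [L.Structure A]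
    [L.Structure B] (h : Equivalent L k' A B) (hk : k ≤ k') : Equivalent L k A B :=
  fun φ hφ => h φ (hφ.trans hk)

theorem exists_index_notMem {ι : Type} {f : ℕ → ι} (hf : Function.Injective f) {F : Set ι}
    (hF : F.Finite) : ∃ c, f c ∉ F := by
  by_contra! h
  exact Set.infinite_range_of_injective hf (hF.subset (Set.range_subset_iff.2 h))

/-! ### Fresh answers between the embeddable and the unembeddable structure -/

section Sequence

variable {k : ℕ} {n : ℕ → ℕ}

/-- The partner is an unused `(n j, n j)`-triple-u. The order of length `n j` is copied and the
other holds at most `n 1` elements, so `S.card ≤ 7 + n 1 + T.card`; as `T` is nonempty, this is at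
most `(8 + n 1) * T.card`. -/
theorem freshAnswers_embeddable_unembeddable
    (h : ∀ i j : ℕ, 1 ≤ i → 1 ≤ j → Equivalent ltLang k (Fin (n i)) (Fin (n j))) :
    FreshAnswers (ι := {j : ℕ // 2 ≤ j} × Bool × ℕ) (ι' := {j : ℕ // 2 ≤ j} × ℕ) k (9 + n 1)
      (fun c => if c.2.1 = true then n 1 else n c.1)
      (fun c => if c.2.1 = true then n c.1 else n 1) (fun c => n c.1) (fun c => n c.1) where
  empty := by
    rintro k' hk s t ⟨⟨j, hj⟩, e, o⟩ F hF
    obtain ⟨o', ho'⟩ := exists_index_notMem (f := fun o => ((⟨j, hj⟩ : {j : ℕ // 2 ≤ j}), o))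
      (fun _ _ h => (Prod.ext_iff.1 h).2) hF
    refine ⟨_, ho', ?_⟩
    cases e
    · exact componentWins_empty ((h j j (by lia) (by lia)).mono hk)
        ((h 1 j le_rfl (by lia)).mono hk) s t
    · exact componentWins_empty ((h 1 j le_rfl (by lia)).mono hk)
        ((h j j (by lia) (by lia)).mono hk) s t
  set := by
    rintro k' hk s t ⟨⟨j, hj⟩, e, o⟩ S hS F hF
    obtain ⟨o', ho'⟩ := exists_index_notMem (f := fun o => ((⟨j, hj⟩ : {j : ℕ // 2 ≤ j}), o))
      (fun _ _ h => (Prod.ext_iff.1 h).2) hF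
    refine ⟨_, ho', ?_⟩
    have h1 := card_le S
    have h2 := Finset.card_le_univ (restr leftEmb S)
    have h3 := Finset.card_le_univ (restr rightEmb S)
    rw [Fintype.card_fin] at h2 h3
    cases e
    · obtain ⟨T, hT, hc, hw⟩ := exists_fresh_of_left (n' := n j) (m' := n j) rfl
        ((h 1 j le_rfl (by lia)).mono hk) s t hS
      refine ⟨T, ?_, hw⟩
      have := hT.card_pos
      simp only [Bool.false_eq_true, if_false] at h3
      nlinarith
    · obtain ⟨T, hT, hc, hw⟩ := exists_fresh_of_right (n' := n j) (m' := n j)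
        ((h 1 j le_rfl (by lia)).mono hk) rfl s t hS
      refine ⟨T, ?_, hw⟩
      have := hT.card_pos
      simp only [if_true] at h2
      nlinarith

theorem freshAnswers_unembeddable_embeddable
    (h : ∀ i j : ℕ, 1 ≤ i → 1 ≤ j → Equivalent ltLang k (Fin (n i)) (Fin (n j))) :
    FreshAnswers (ι := {j : ℕ // 2 ≤ j} × ℕ) (ι' := {j : ℕ // 2 ≤ j} × Bool × ℕ) k (9 + n 1)
      (fun c => n c.1) (fun c => n c.1) (fun c => if c.2.1 = true then n 1 else n c.1)
      (fun c => if c.2.1 = true then n c.1 else n 1) where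
  empty := by
    rintro k' hk s t ⟨⟨j, hj⟩, o⟩ F hF
    obtain ⟨o', ho'⟩ := exists_index_notMem
      (f := fun o => ((⟨j, hj⟩ : {j : ℕ // 2 ≤ j}), true, o))
      (fun _ _ h => (Prod.ext_iff.1 (Prod.ext_iff.1 h).2).2) hF
    exact ⟨_, ho', componentWins_empty ((h j 1 (by lia) le_rfl).mono hk)
        ((h j j (by lia) (by lia)).mono hk) s t⟩
  set := by
    rintro k' hk s t ⟨⟨j, hj⟩, o⟩ S hS F hF
    have h1 := card_le S
    -- The partner retains the order of length `n j` on the side where `S` is larger, and that part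
    -- is copied. Hence `S.card ≤ 7 + 2 * T.card ≤ 9 * T.card` for the nonempty `T`, which explains
    -- the 9 in the factor.
    rcases le_total (restr leftEmb S).card (restr rightEmb S).card with hle | hle
    · obtain ⟨o', ho'⟩ := exists_index_notMem
        (f := fun o => ((⟨j, hj⟩ : {j : ℕ // 2 ≤ j}), true, o))
        (fun _ _ h => (Prod.ext_iff.1 (Prod.ext_iff.1 h).2).2) hF
      obtain ⟨T, hT, hc, hw⟩ := exists_fresh_of_right (n' := n 1) (m' := n j)
        ((h j 1 (by lia) le_rfl).mono hk) rfl s t hS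
      refine ⟨_, ho', T, ?_, hw⟩
      have := hT.card_pos
      nlinarith
    · obtain ⟨o', ho'⟩ := exists_index_notMem
        (f := fun o => ((⟨j, hj⟩ : {j : ℕ // 2 ≤ j}), false, o))
        (fun _ _ h => (Prod.ext_iff.1 (Prod.ext_iff.1 h).2).2) hF
      obtain ⟨T, hT, hc, hw⟩ := exists_fresh_of_left (n' := n j) (m' := n 1) rfl
        ((h j 1 (by lia) le_rfl).mono hk) s t hS
      refine ⟨_, ho', T, ?_, hw⟩
      have := hT.card_pos
      nlinarith

end Sequence

end WMSOB

theorem mainTheorem9 (k : ℕ) (n : ℕ → ℕ) (hn : StrictMonoOn n (Set.Ici 1))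
    (hequiv : ∀ i j : ℕ, 1 ≤ i → 1 ≤ j →
      WMSOB.Equivalent WMSOB.ltLang k (Fin (n i)) (Fin (n j))) :
    WMSOB.DuplicatorHasWinningStrategy WMSOB.ltPerpLang k
      (WMSOB.Embeddable n) (WMSOB.Unembeddable n) :=
  (WMSOB.existsMatching_empty k).duplicatorWins
    (WMSOB.freshAnswers_embeddable_unembeddable hequiv)
    (WMSOB.freshAnswers_unembeddable_embeddable hequiv) le_rfl
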